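/- Corollary 3 (Riesz–Thorin estimate). Let $n>2$ be an integer, let $\mathbf B$ be the open unit ball of $\mathbf R^n$ with Lebesgue measure, let $|\cdot|$ be the Euclidean norm, and let $\omega_{n-1}$ be the surface area of the unit sphere of $\mathbf R^n$. Put $[x,y]=\bigl|\,x|y|-y/|y|\,\bigr|$ for $y\neq0$, $[x,0]=1$, and $$H(x,y)=\frac{x-y}{|x-y|^n}-\frac{|y|^2x-y}{[x,y]^n}.$$ For real-valued $f$ on $\mathbf B$ let $$\mathcal D[f](x)=\frac1{\omega_{n-1}}\int_{\mathbf B}H(x,y)f(y)\,dy,\qquad \mathcal N[f](x)=\frac1{\omega_{n-1}}\int_{\mathbf B}|H(x,y)|f(y)\,dy .$$ Write $\|\mathcal N\|_p$ and $\|\mathcal D\|_p$ for the norms $\sup\{\|Tf\|_p:\|f\|_p=1\}$ of $T=\mathcal N:L^p(\mathbf B)\to L^p(\mathbf B)$ and $T=\mathcal D:L^p(\mathbf B)\to L^p(\mathbf B,\mathbf R^n)$. Let $1<p<\infty$. Then $\mathcal D$ is well defined and bounded on $L^p(\mathbf B)$, $\mathcal N$ is well defined and bounded on $L^p(\mathbf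 B)$, on $L^1(\mathbf B)$ and on $L^\infty(\mathbf B)$ (the integrals converge absolutely for almost every $x\in\mathbf B$), and $$\|\mathcal D\|_p<\|\mathcal N\|_p\le\|\mathcal N\|_1^{1/p}\,\|\mathcal N\|_\infty^{(p-1)/p}.$$ -/

import Mathlib

open MeasureTheory Metric
open scoped ENNReal

namespace PoissonGradient

noncomputable section

/-- The space `ℝⁿ` with the Euclidean norm. -/
abbrev Space (n : ℕ) : Type := EuclideanSpace ℝ (Fin n)

/-- Lebesgue measure on the open unit ball `B` of `ℝⁿ`. -/
def ballMeasure (n : ℕ) : Measure (Space n) :=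
  (volume : Measure (Space n)).restrict (ball (0 : Space n) 1)

/-- The surface area `ω_{n-1}` of the unit sphere of `ℝⁿ`. -/
def sphereArea (n : ℕ) : ℝ :=
  (volume : Measure (Space n)).toSphere.real Set.univ

/-- `[x, y] = |x |y| - y / |y||`, with its continuous extension `[x, 0] = 1`. -/
def bracket {n : ℕ} (x y : Space n) : ℝ :=
  if y = 0 then 1 else ‖‖y‖ • x - ‖y‖⁻¹ • y‖

/-- The vector kernel `(x - y) / |x - y|ⁿ - (|y|² x - y) / [x, y]ⁿ`. -/
def gradKernel {n : ℕ} (x y : Space n) : Space n :=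
  (‖x - y‖ ^ n)⁻¹ • (x - y) - (bracket x y ^ n)⁻¹ • (‖y‖ ^ 2 • x - y)

/-- The integral operator `f ↦ (x ↦ (1 / ω_{n-1}) ∫_B k(x, y) f(y) dy)` with the scalar or
vector kernel `k`. -/
def integralOp {n : ℕ} {F : Type*} [NormedAddCommGroup F] [NormedSpace ℝ F]
    (k : Space n → Space n → F) (f : Space n → ℝ) (x : Space n) : F :=
  (sphereArea n)⁻¹ • ∫ y, f y • k x y ∂(ballMeasure n)

/-- The operator `𝒟`, the gradient of the solution of the Poisson equation. -/
def opD {n : ℕ} (f : Space n → ℝ) : Space n → Space n :=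
  integralOp (fun x y => gradKernel x y) f

/-- The operator `𝒩`, whose kernel is the Euclidean norm of that of `𝒟`. -/
def opN {n : ℕ} (f : Space n → ℝ) : Space n → ℝ :=
  integralOp (fun x y => ‖gradKernel x y‖) f

/-- The norm `‖T‖_p = sup {‖T f‖_p : ‖f‖_p = 1}` of an operator on `L^p(B)`, in `[0, ∞]`. -/
def lpOpNorm {n : ℕ} {F : Type*} [NormedAddCommGroup F]
    (T : (Space n → ℝ) → Space n → F) (p : ℝ≥0∞) : ℝ≥0∞ :=
  ⨆ (f : Space n → ℝ) (_ : MemLp f p (ballMeasure n)) (_ : eLpNorm f p (ballMeasure n) = 1),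
    eLpNorm (T f) p (ballMeasure n)

/-- The integral operator with kernel `k` is well defined and bounded on `L^p(B)`: for `f` in
`L^p(B)` the defining integral converges absolutely at almost every point of `B`, the result is
again in `L^p`, and the operator norm is finite. -/
def BoundedOnLp {n : ℕ} {F : Type*} [NormedAddCommGroup F] [NormedSpace ℝ F]
    (k : Space n → Space n → F) (p : ℝ≥0∞) : Prop :=
  (∀ f : Space n → ℝ, MemLp f p (ballMeasure n) →
    (∀ᵐ x ∂(ballMeasure n), Integrable (fun y => f y • k x y) (ballMeasure n)) ∧
      MemLp (integralOp k f) p (ballMeasure n)) ∧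
  lpOpNorm (integralOp k) p < ∞

end

end PoissonGradient

/-! On the ball `|x - y| < [x, y]`, and `|y|² x - y` has norm `|y| [x, y]`, so `|H(x, y)| ≤ 2 |x -
y|^(1 - n)`. This is integrable near the diagonal, so `∫ |H| dy` and `∫ |H| dx` are bounded, and the
Schur test (`eLpNorm_kernel_mul_le`) gives boundedness on every `L^p`. Testing `𝒩` on the constant
`1` and on indicators shows that the two marginals, scaled by `1 / ω_{n-1}`, are at most `‖𝒩‖_∞` and
`‖𝒩‖_1`. With these bounds the Schur constant is the Riesz–Thorin one, and no interpolation is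
needed.

For `‖𝒟‖_p < ‖𝒩‖_p`, a strict inequality for each `f` is not enough, since the supremum need not be
attained. A gap uniform over `‖f‖_p = 1` comes from two cases, with `L = ‖𝒩‖_p`. If `‖f‖_1` is
small, split the kernel into a bounded part and a part with small Schur bounds: both `𝒟 f` and `𝒩
|f|` have norm at most `L / 2`. If `‖f‖_1 ≥ c`, then `(∫ |u|)² - |∫ u|²` is the double integral of
`|u(y)| |u(z)| - ⟨u(y), u(z)⟩`. For `u = f H(x, ·)` this is at least `|f(y)| |f(z)|` times the
Cauchy–Schwarz defect of `H(x, y)` and `H(x, z)`. For independent `x, y, z`, hence almost everywhere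
when `n > 2`, the defect is positive. After cutting `f` off at a fixed height, the loss is bounded
below uniformly in `f` (`exists_pos_lintegral_rpow_add_le`). -/

namespace PoissonGradient

/-! ### The Schur test -/

section Schur

variable {α β : Type*} [MeasurableSpace α] [MeasurableSpace β] {μ : Measure α} {ν : Measure β} {K : α → β → ℝ≥0∞} {g : β → ℝ≥0∞} {A B : ℝ≥0∞}

theorem aemeasurable_kernel_mul (hK : Measurable (Function.uncurry K)) (hg : AEMeasurable g ν) :
    AEMeasurable (Function.uncurry fun x y => K x y * g y) (μ.prod ν) :=
  hK.aemeasurable.mul hg.comp_snd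

theorem lintegral_lintegral_kernel_mul_le [SFinite μ] [SFinite ν]
    (hK : Measurable (Function.uncurry K))
    (hg : AEMeasurable g ν) (hB : ∀ᵐ y ∂ν, ∫⁻ x, K x y ∂μ ≤ B) :
    ∫⁻ x, ∫⁻ y, K x y * g y ∂ν ∂μ ≤ B * ∫⁻ y, g y ∂ν := by
  rw [lintegral_lintegral_swap (aemeasurable_kernel_mul hK hg), ← lintegral_const_mul'' _ hg]
  refine lintegral_mono_ae ?_
  filter_upwards [hB] with y hy
  rw [lintegral_mul_const _ (by fun_prop)]
  gcongr

/-- Hölder's inequality for the factorisation `k g = (k^(1/p) g) · k^(1/q)`. -/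
theorem rpow_lintegral_kernel_mul_le {p : ℝ} (hp : 1 < p) {k : β → ℝ≥0∞} (hk : Measurable k)
    (hg : AEMeasurable g ν) :
    (∫⁻ y, k y * g y ∂ν) ^ p ≤ (∫⁻ y, k y ∂ν) ^ (p - 1) * ∫⁻ y, k y * g y ^ p ∂ν := by
  have hp0 : 0 < p := by linarith
  have hpq := Real.HolderConjugate.conjExponent hp
  set q := p.conjExponent with hq
  have hq0 : 0 < q := hpq.symm.pos
  have h := ENNReal.lintegral_mul_le_Lp_mul_Lq ν hpq
    (f := fun y => k y ^ (1 / p) * g y) (g := fun y => k y ^ (1 / q)) (by fun_prop) (by fun_prop)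
  have e1 : ∀ y, ((fun y => k y ^ (1 / p) * g y) * (fun y => k y ^ (1 / q))) y = k y * g y := by
    intro y
    simp only [Pi.mul_apply]
    rw [mul_right_comm, ← ENNReal.rpow_add_of_nonneg _ _ (by positivity) (by positivity)]
    have : 1 / p + 1 / q = 1 := by simpa using hpq.inv_add_inv_eq_one
    rw [this, ENNReal.rpow_one]
  have e2 : ∀ y, (k y ^ (1 / p) * g y) ^ p = k y * g y ^ p := by
    intro y
    rw [ENNReal.mul_rpow_of_nonneg _ _ hp0.le, ← ENNReal.rpow_mul, one_div_mul_cancel hp0.ne',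
      ENNReal.rpow_one]
  have e3 : ∀ y, (k y ^ (1 / q)) ^ q = k y := by
    intro y
    rw [← ENNReal.rpow_mul, one_div_mul_cancel hq0.ne', ENNReal.rpow_one]
  simp only [e1, e2, e3] at h
  calc (∫⁻ y, k y * g y ∂ν) ^ p
      ≤ ((∫⁻ y, k y * g y ^ p ∂ν) ^ (1 / p) * (∫⁻ y, k y ∂ν) ^ (1 / q)) ^ p := by gcongr
    _ = _ := by
      rw [ENNReal.mul_rpow_of_nonneg _ _ hp0.le, ← ENNReal.rpow_mul, ← ENNReal.rpow_mul,
        one_div_mul_cancel hp0.ne', ENNReal.rpow_one, mul_comm]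
      congr 2
      -- The exponents agree because `p / q = p - 1`.
      have := hpq.sub_one_mul_conj
      field_simp
      linarith

/-- The **Schur test**, with the constant of the Riesz–Thorin theorem. -/
theorem eLpNorm_kernel_mul_le [SFinite μ] [SFinite ν] {p : ℝ≥0∞} (hp : 1 ≤ p) (hK : Measurable (Function.uncurry K))
    (hg : AEMeasurable g ν) (hA : ∀ᵐ x ∂μ, ∫⁻ y, K x y ∂ν ≤ A)
    (hB : ∀ᵐ y ∂ν, ∫⁻ x, K x y ∂μ ≤ B) :
    eLpNorm (fun x => ∫⁻ y, K x y * g y ∂ν) p μ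
      ≤ B ^ (1 / p.toReal) * A ^ (1 - 1 / p.toReal) * eLpNorm g p ν := by
  rcases eq_or_ne p ∞ with rfl | hpt
  · simp only [ENNReal.toReal_top, div_zero, ENNReal.rpow_zero, sub_zero, ENNReal.rpow_one,
      one_mul, eLpNorm_exponent_top]
    refine eLpNormEssSup_le_of_ae_enorm_bound ?_
    filter_upwards [hA] with x hx
    calc ∫⁻ y, K x y * g y ∂ν ≤ ∫⁻ y, K x y * eLpNormEssSup g ν ∂ν := by
          refine lintegral_mono_ae ?_
          filter_upwards [enorm_ae_le_eLpNormEssSup g ν] with y hy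
          gcongr
          simpa using hy
      _ ≤ A * eLpNormEssSup g ν := by
          rw [lintegral_mul_const _ (by fun_prop)]
          gcongr
  rcases hp.eq_or_lt with rfl | hp1
  · simp only [ENNReal.toReal_one, div_one, ENNReal.rpow_one, sub_self, ENNReal.rpow_zero, mul_one,
      eLpNorm_one_eq_lintegral_enorm, enorm_eq_self]
    exact lintegral_lintegral_kernel_mul_le hK hg hB
  have hp0 : p ≠ 0 := by positivity
  have hr : 1 < p.toReal := by
    rwa [← ENNReal.toReal_one, ENNReal.toReal_lt_toReal (by simp) hpt]
  set r := p.toReal with hrdef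
  have hr0 : 0 < r := by linarith
  rw [eLpNorm_eq_lintegral_rpow_enorm_toReal hp0 hpt, eLpNorm_eq_lintegral_rpow_enorm_toReal hp0 hpt,
    ← hrdef]
  simp only [enorm_eq_self]
  calc (∫⁻ x, (∫⁻ y, K x y * g y ∂ν) ^ r ∂μ) ^ (1 / r)
      ≤ (A ^ (r - 1) * (B * ∫⁻ y, g y ^ r ∂ν)) ^ (1 / r) := by
        gcongr
        have hm : AEMeasurable (fun x => ∫⁻ y, K x y * g y ^ r ∂ν) μ :=
          (aemeasurable_kernel_mul (μ := μ) hK (hg.pow_const r)).lintegral_prod_right'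
        calc ∫⁻ x, (∫⁻ y, K x y * g y ∂ν) ^ r ∂μ
            ≤ ∫⁻ x, A ^ (r - 1) * ∫⁻ y, K x y * g y ^ r ∂ν ∂μ := by
              refine lintegral_mono_ae ?_
              filter_upwards [hA] with x hx
              refine (rpow_lintegral_kernel_mul_le hr (by fun_prop) hg).trans ?_
              gcongr
          _ ≤ _ := by
              rw [lintegral_const_mul'' _ hm]
              gcongr
              exact lintegral_lintegral_kernel_mul_le hK (hg.pow_const r) hB
    _ = _ := by
        rw [ENNReal.mul_rpow_of_nonneg _ _ (by positivity),
          ENNReal.mul_rpow_of_nonneg _ _ (by positivity), ← ENNReal.rpow_mul, mul_left_comm,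
          ← mul_assoc]
        congr 3
        field_simp

end Schur

/-! ### The loss in the triangle inequality for vector integrals -/

section Gap

variable {α E : Type*} [MeasurableSpace α] {μ : Measure α} [NormedAddCommGroup E]
  [InnerProductSpace ℝ E]

/-- The defect of the Cauchy–Schwarz inequality. -/
noncomputable def cauchySchwarzDefect (a b : E) : ℝ := ‖a‖ * ‖b‖ - |inner ℝ a b|

theorem cauchySchwarzDefect_nonneg (a b : E) : 0 ≤ cauchySchwarzDefect a b :=
  sub_nonneg.2 (abs_real_inner_le_norm a b)

theorem sq_norm_integral_eq [CompleteSpace E] {u : α → E} (hu : Integrable u μ) :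
    (∫ y, ‖u y‖ ∂μ) ^ 2 - ‖∫ y, u y ∂μ‖ ^ 2
      = ∫ y, ∫ z, (‖u y‖ * ‖u z‖ - inner ℝ (u y) (u z)) ∂μ ∂μ := by
  have h1 : ∀ y, ∫ z, (‖u y‖ * ‖u z‖ - inner ℝ (u y) (u z)) ∂μ
      = ‖u y‖ * (∫ z, ‖u z‖ ∂μ) - inner ℝ (∫ z, u z ∂μ) (u y) := by
    intro y
    rw [integral_sub (hu.norm.const_mul _) (hu.const_inner _), integral_const_mul,
      integral_inner hu, real_inner_comm]
  simp_rw [h1]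
  rw [integral_sub (hu.norm.mul_const _) (hu.const_inner _), integral_mul_const,
    integral_inner hu, real_inner_self_eq_norm_sq, sq]

/-- Putting `|⟨·,·⟩|` for the inner product only lowers the integrand, and makes it insensitive to
the sign of a scalar factor of `u`. -/
theorem lintegral_defect_le_sq_sub_sq [CompleteSpace E] [SFinite μ] {u : α → E}
    (hu : Integrable u μ) :
    ∫⁻ y, ∫⁻ z, ENNReal.ofReal (cauchySchwarzDefect (u y) (u z)) ∂μ ∂μ
      ≤ ENNReal.ofReal ((∫ y, ‖u y‖ ∂μ) ^ 2 - ‖∫ y, u y ∂μ‖ ^ 2) := by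
  have hnn : ∀ y z, 0 ≤ ‖u y‖ * ‖u z‖ - inner ℝ (u y) (u z) := fun y z =>
    sub_nonneg.2 (real_inner_le_norm _ _)
  have hi : ∀ y, Integrable (fun z => ‖u y‖ * ‖u z‖ - inner ℝ (u y) (u z)) μ := fun y =>
    (hu.norm.const_mul _).sub (hu.const_inner _)
  have h1 : ∀ y, ∫ z, (‖u y‖ * ‖u z‖ - inner ℝ (u y) (u z)) ∂μ
      = ‖u y‖ * (∫ z, ‖u z‖ ∂μ) - inner ℝ (∫ z, u z ∂μ) (u y) := by
    intro y
    rw [integral_sub (hu.norm.const_mul _) (hu.const_inner _), integral_const_mul,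
      integral_inner hu, real_inner_comm]
  have hi2 : Integrable (fun y => ∫ z, (‖u y‖ * ‖u z‖ - inner ℝ (u y) (u z)) ∂μ) μ := by
    simp_rw [h1]
    exact (hu.norm.mul_const _).sub (hu.const_inner _)
  rw [sq_norm_integral_eq hu, ofReal_integral_eq_lintegral_ofReal hi2
    (.of_forall fun y => integral_nonneg (hnn y))]
  refine lintegral_mono fun y => ?_
  simp only
  rw [ofReal_integral_eq_lintegral_ofReal (hi y) (.of_forall (hnn y))]
  refine lintegral_mono fun z => ENNReal.ofReal_le_ofReal ?_
  exact sub_le_sub_left (le_abs_self _) _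

theorem cauchySchwarzDefect_smul (s t : ℝ) (a b : E) :
    cauchySchwarzDefect (s • a) (t • b) = |s| * |t| * cauchySchwarzDefect a b := by
  simp only [cauchySchwarzDefect, norm_smul, real_inner_smul_left, real_inner_smul_right,
    Real.norm_eq_abs, abs_mul]
  ring

/-- The loss in the triangle inequality for `∫ f • v` is at least that of the part of `f` where
values are cut off at height `M`. -/
theorem norm_integral_add_defect_le [CompleteSpace E] [SFinite μ] {f : α → ℝ} {v : α → E}
    {M A : ℝ} (hM : 0 < M) (hA : 0 < A) (hf : AEStronglyMeasurable f μ) (hv : Integrable v μ)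
    (hfv : Integrable (fun y => f y • v y) μ) (hvA : ∫ y, ‖v y‖ ∂μ ≤ A) :
    ‖∫ y, f y • v y ∂μ‖ₑ + ENNReal.ofReal (2 * M * A)⁻¹ *
        ∫⁻ y, ∫⁻ z, ENNReal.ofReal (cauchySchwarzDefect (v y) (v z)) *
          (ENNReal.ofReal (min |f y| M) * ENNReal.ofReal (min |f z| M)) ∂μ ∂μ
      ≤ ∫⁻ y, ‖v y‖ₑ * ‖f y‖ₑ ∂μ := by
  set f₁ : α → ℝ := fun y => max (-M) (min (f y) M) with hf₁
  have habs : ∀ y, |f₁ y| = min |f y| M := by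
    intro y
    simp only [hf₁]
    rcases le_total 0 (f y) with h | h
    · rw [max_eq_right (by rw [le_min_iff]; constructor <;> linarith), abs_of_nonneg h,
        abs_of_nonneg (le_min h hM.le)]
    · rw [min_eq_left (h.trans hM.le), abs_of_nonpos h, abs_of_nonpos (max_le (by linarith) h),
        ← min_neg_neg, neg_neg, min_comm]
  -- `f` and its truncation have the same sign, so `|f| = |f₁| + |f - f₁|`; the triangle inequality
  -- on the remainder then leaves the loss of `f₁` intact.
  have hdiff : ∀ y, |f y - f₁ y| = |f y| - |f₁ y| := by
    intro y
    rw [habs]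
    simp only [hf₁]
    rcases le_total 0 (f y) with h | h
    · rw [max_eq_right (by rw [le_min_iff]; constructor <;> linarith), abs_of_nonneg h,
        abs_of_nonneg (sub_nonneg.2 (min_le_left _ _))]
    · rw [min_eq_left (h.trans hM.le), abs_of_nonpos h,
        abs_of_nonpos (sub_nonpos.2 (le_max_right _ _)), min_def, max_def]
      split_ifs <;> linarith
  have hf₁m : AEStronglyMeasurable f₁ μ :=
    (aestronglyMeasurable_const (b := -M)).sup (hf.inf (aestronglyMeasurable_const (b := M)))
  have hle : ∀ y, |f₁ y| ≤ M := fun y => by rw [habs]; exact min_le_right _ _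
  have hi₁ : Integrable (fun y => f₁ y • v y) μ := by
    refine (hv.norm.const_mul M).mono' (hf₁m.smul hv.1) (.of_forall fun y => ?_)
    rw [norm_smul, Real.norm_eq_abs]
    exact mul_le_mul_of_nonneg_right (hle y) (norm_nonneg _)
  have hi₂ : Integrable (fun y => (f y - f₁ y) • v y) μ := by
    simp only [sub_smul]
    exact hfv.sub hi₁
  set a := ∫ y, ‖f₁ y • v y‖ ∂μ with ha
  set b := ‖∫ y, f₁ y • v y ∂μ‖ with hb
  have hab : b ≤ a := norm_integral_le_integral_norm _
  have hb0 : 0 ≤ b := norm_nonneg _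
  have haM : a ≤ M * A := by
    calc a ≤ ∫ y, M * ‖v y‖ ∂μ := by
          refine integral_mono hi₁.norm (hv.norm.const_mul M) fun y => ?_
          simp only [norm_smul, Real.norm_eq_abs]
          exact mul_le_mul_of_nonneg_right (hle y) (norm_nonneg _)
      _ ≤ M * A := by rw [integral_const_mul]; gcongr
  have hgap : ‖∫ y, f y • v y ∂μ‖ + (a - b) ≤ ∫ y, ‖f y • v y‖ ∂μ := by
    have e : ∫ y, f y • v y ∂μ = ∫ y, f₁ y • v y ∂μ + ∫ y, (f y - f₁ y) • v y ∂μ := by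
      rw [← integral_add hi₁ hi₂]
      congr 1 with y
      rw [sub_smul]; abel
    have h2 : ∫ y, ‖(f y - f₁ y) • v y‖ ∂μ = ∫ y, ‖f y • v y‖ ∂μ - a := by
      rw [ha, ← integral_sub hfv.norm hi₁.norm]
      congr 1 with y
      simp only [norm_smul, Real.norm_eq_abs, hdiff]
      ring
    have h3 := norm_integral_le_integral_norm (μ := μ) (fun y => (f y - f₁ y) • v y)
    have h4 := norm_add_le (∫ y, f₁ y • v y ∂μ) (∫ y, (f y - f₁ y) • v y ∂μ)
    rw [e] at *
    linarith
  -- Factor `a² - b² = (a - b)(a + b)`, where `a + b ≤ 2 M A`.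
  have hsq : (2 * M * A)⁻¹ * (a ^ 2 - b ^ 2) ≤ a - b := by
    rw [inv_mul_le_iff₀ (by positivity)]
    nlinarith
  have hR : ∫⁻ y, ‖v y‖ₑ * ‖f y‖ₑ ∂μ = ENNReal.ofReal (∫ y, ‖f y • v y‖ ∂μ) := by
    rw [ofReal_integral_norm_eq_lintegral_enorm hfv]
    simp only [enorm_smul, mul_comm]
  rw [hR]
  refine le_trans ?_ (ENNReal.ofReal_le_ofReal hgap)
  rw [ENNReal.ofReal_add (norm_nonneg _) (by linarith), ofReal_norm]
  gcongr
  refine le_trans ?_ (ENNReal.ofReal_le_ofReal hsq)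
  rw [ENNReal.ofReal_mul (by positivity)]
  gcongr
  refine le_trans (le_of_eq ?_) (lintegral_defect_le_sq_sub_sq hi₁)
  congr 1 with y
  congr 1 with z
  rw [cauchySchwarzDefect_smul, habs, habs, ENNReal.ofReal_mul (by positivity),
    ENNReal.ofReal_mul (by positivity), mul_comm]

end Gap

/-! ### Lower bounds uniform in the function -/

section UniformGap

/-- The sets `{C < 1/(k+1)}` decrease to a null set, so one of them carries at most half of the mass
`m` of any `ψ ≤ M`. Off that set `C` is at least `t = 1/(k+1)`. -/
theorem exists_pos_le_lintegral_mul {Ω : Type*} [MeasurableSpace Ω] {ρ : Measure Ω}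
    [IsFiniteMeasure ρ] {C : Ω → ℝ≥0∞} (hC : Measurable C) (hpos : ∀ᵐ z ∂ρ, 0 < C z)
    {M m : ℝ≥0∞} (hM : M ≠ ∞) (hm : m ≠ 0) (hm' : m ≠ ∞) :
    ∃ κ, κ ≠ 0 ∧ ∀ ψ : Ω → ℝ≥0∞, AEMeasurable ψ ρ → (∀ z, ψ z ≤ M) → m ≤ ∫⁻ z, ψ z ∂ρ →
      κ ≤ ∫⁻ z, C z * ψ z ∂ρ := by
  have hlim : Filter.Tendsto (fun k : ℕ => M * ρ {z | C z < (k + 1 : ℝ≥0∞)⁻¹}) Filter.atTop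
      (nhds 0) := by
    have h := tendsto_measure_iInter_atTop (μ := ρ) (s := fun k : ℕ => {z | C z < (k + 1 : ℝ≥0∞)⁻¹})
      (fun k => (measurableSet_lt hC measurable_const).nullMeasurableSet)
      (fun i j hij z hz => lt_of_lt_of_le (Set.mem_ofPred.1 hz) (by gcongr))
      ⟨0, measure_ne_top _ _⟩
    have h0 : ρ (⋂ k : ℕ, {z | C z < (k + 1 : ℝ≥0∞)⁻¹}) = 0 := by
      refine measure_mono_null ?_ (ae_iff.1 hpos)
      intro z hz
      simp only [Set.mem_iInter, Set.mem_ofPred_eq] at hz ⊢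
      intro hz0
      obtain ⟨k, hk⟩ := ENNReal.exists_inv_nat_lt hz0.ne'
      refine absurd (hz k) (not_lt.2 (le_trans ?_ hk.le))
      rw [ENNReal.inv_le_inv]
      exact le_self_add
    rw [h0] at h
    simpa using ENNReal.Tendsto.const_mul h (Or.inr hM)
  have hm2 : 0 < m / 2 := ENNReal.half_pos hm
  obtain ⟨k, hk⟩ := (hlim.eventually (gt_mem_nhds hm2)).exists
  set t : ℝ≥0∞ := (k + 1 : ℝ≥0∞)⁻¹ with ht
  have ht0 : t ≠ 0 := ENNReal.inv_ne_zero.2 (by finiteness)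
  have htt : t ≠ ∞ := by simp [ht]
  refine ⟨t * (m / 2), mul_ne_zero ht0 hm2.ne', fun ψ hψ hψM hmψ => ?_⟩
  have hS : MeasurableSet {z | C z < t} := measurableSet_lt hC measurable_const
  have h1 : ∫⁻ z, ψ z ∂ρ ≤ m / 2 + t⁻¹ * ∫⁻ z, C z * ψ z ∂ρ := by
    calc ∫⁻ z, ψ z ∂ρ ≤ ∫⁻ z, ({z | C z < t}.indicator (fun _ => M) z + t⁻¹ * (C z * ψ z)) ∂ρ := by
          refine lintegral_mono fun z => ?_
          by_cases hz : C z < t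
          · rw [Set.indicator_of_mem (by exact hz)]
            exact (hψM z).trans le_self_add
          · rw [Set.indicator_of_notMem (by exact hz), zero_add, ← mul_assoc]
            calc ψ z = t⁻¹ * t * ψ z := by rw [ENNReal.inv_mul_cancel ht0 htt, one_mul]
              _ ≤ _ := by gcongr; exact not_lt.1 hz
      _ = M * ρ {z | C z < t} + t⁻¹ * ∫⁻ z, C z * ψ z ∂ρ := by
          rw [lintegral_add_left (measurable_const.indicator hS), lintegral_indicator_const hS,
            lintegral_const_mul'' (f := fun z => C z * ψ z) _ (by fun_prop)]
      _ ≤ _ := by gcongr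
  have h2 : m / 2 ≤ t⁻¹ * ∫⁻ z, C z * ψ z ∂ρ := by
    have h3 := hmψ.trans h1
    rw [← ENNReal.add_halves m] at h3
    refine (ENNReal.add_le_add_iff_left (a := m / 2) (by finiteness)).1 ?_
    simpa [ENNReal.add_halves] using h3
  calc t * (m / 2) ≤ t * (t⁻¹ * ∫⁻ z, C z * ψ z ∂ρ) := by gcongr
    _ = _ := by rw [← mul_assoc, ENNReal.mul_inv_cancel ht0 htt, one_mul]

theorem ae_lt_top_of_eLpNorm_lt_top {α : Type*} [MeasurableSpace α] {μ : Measure α}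
    {p : ℝ≥0∞} (hp : p ≠ 0) {h : α → ℝ≥0∞} (hh : AEMeasurable h μ) (hfin : eLpNorm h p μ < ∞) :
    ∀ᵐ x ∂μ, h x < ∞ := by
  rcases eq_or_ne p ∞ with rfl | hpt
  · rw [eLpNorm_exponent_top] at hfin
    filter_upwards [enorm_ae_le_eLpNormEssSup h μ] with x hx
    exact lt_of_le_of_lt (by simpa using hx) hfin
  · rw [eLpNorm_eq_lintegral_rpow_enorm_toReal hp hpt] at hfin
    have hr : 0 < p.toReal := ENNReal.toReal_pos hp hpt
    have h1 : ∫⁻ x, h x ^ p.toReal ∂μ ≠ ∞ := by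
      intro h2
      simp only [enorm_eq_self, h2] at hfin
      simp [ENNReal.top_rpow_of_pos, hr] at hfin
    filter_upwards [ae_lt_top' (hh.pow_const _) h1] with x hx
    rwa [ENNReal.rpow_lt_top_iff_of_pos hr] at hx

theorem le_min_add_rpow {p M t : ℝ} (hp : 1 < p) (hM : 0 < M) (ht : 0 ≤ t) :
    t ≤ min t M + M ^ (1 - p) * t ^ p := by
  rcases le_or_gt t M with h | h
  · rw [min_eq_left h]
    have : 0 ≤ M ^ (1 - p) * t ^ p := by positivity
    linarith
  · rw [min_eq_right h.le]
    have h0 : 0 < t := hM.trans h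
    have h1 : t ^ (1 - p) ≤ M ^ (1 - p) :=
      Real.rpow_le_rpow_of_nonpos hM h.le (by linarith)
    calc t = t ^ (1 - p) * t ^ p := by rw [← Real.rpow_add h0]; simp
      _ ≤ M ^ (1 - p) * t ^ p := by gcongr
      _ ≤ _ := by linarith

/-- The `L^p` bound makes the mass lost by the cutoff at most `M^(1-p)`, which tends to `0` as `M`
grows; hence `M` depends only on `p` and `c`. -/
theorem exists_pos_half_le_lintegral_min {α : Type*} [MeasurableSpace α] {μ : Measure α}
    {p : ℝ} (hp : 1 < p) {c : ℝ≥0∞} (hc : c ≠ 0) (hc' : c ≠ ∞) :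
    ∃ M : ℝ, 0 < M ∧ ∀ f : α → ℝ, AEStronglyMeasurable f μ → ∫⁻ y, ‖f y‖ₑ ^ p ∂μ ≤ 1 →
      c ≤ ∫⁻ y, ‖f y‖ₑ ∂μ → c / 2 ≤ ∫⁻ y, ENNReal.ofReal (min |f y| M) ∂μ := by
  have hc2 : 0 < (c / 2).toReal := ENNReal.toReal_pos (ENNReal.half_pos hc).ne' (by finiteness)
  have hlim := tendsto_rpow_neg_atTop (y := p - 1) (by linarith)
  obtain ⟨M, hM, hM0⟩ := ((hlim.eventually (gt_mem_nhds hc2)).and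
    (Filter.eventually_gt_atTop 0)).exists
  refine ⟨M, hM0, fun f hf hf1 hcf => ?_⟩
  have h1 : ∫⁻ y, ‖f y‖ₑ ∂μ ≤ ∫⁻ y, ENNReal.ofReal (min |f y| M) ∂μ + c / 2 := by
    calc ∫⁻ y, ‖f y‖ₑ ∂μ
        ≤ ∫⁻ y, (ENNReal.ofReal (min |f y| M) + ENNReal.ofReal (M ^ (1 - p)) * ‖f y‖ₑ ^ p) ∂μ := by
          refine lintegral_mono fun y => ?_
          rw [Real.enorm_eq_ofReal_abs, ENNReal.ofReal_rpow_of_nonneg (abs_nonneg _) (by linarith),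
            ← ENNReal.ofReal_mul (by positivity), ← ENNReal.ofReal_add (by positivity)
            (by positivity)]
          exact ENNReal.ofReal_le_ofReal (le_min_add_rpow hp hM0 (abs_nonneg _))
      _ = ∫⁻ y, ENNReal.ofReal (min |f y| M) ∂μ
          + ENNReal.ofReal (M ^ (1 - p)) * ∫⁻ y, ‖f y‖ₑ ^ p ∂μ := by
          rw [lintegral_add_right' _ (by fun_prop), lintegral_const_mul'' _ (by fun_prop)]
      _ ≤ _ := by
          gcongr
          calc ENNReal.ofReal (M ^ (1 - p)) * ∫⁻ y, ‖f y‖ₑ ^ p ∂μ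
              ≤ ENNReal.ofReal (c / 2).toReal * 1 := by
                gcongr
                rw [neg_sub] at hM
                exact hM.le
            _ = c / 2 := by rw [mul_one, ENNReal.ofReal_toReal (by finiteness)]
  have h2 := hcf.trans h1
  rw [← ENNReal.add_halves c] at h2
  refine (ENNReal.add_le_add_iff_right (a := c / 2) (by finiteness)).1 ?_
  simpa [ENNReal.add_halves] using h2

theorem one_div_toReal_le_one {p : ℝ≥0∞} (hp : 1 ≤ p) : 1 / p.toReal ≤ 1 := by
  rcases eq_or_ne p ∞ with rfl | hpt
  · simp
  · have : 1 ≤ p.toReal := by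
      rwa [← ENNReal.toReal_one, ENNReal.toReal_le_toReal (by simp) hpt]
    rw [div_le_one (by positivity)]
    exact this

variable {α : Type*} [MeasurableSpace α] {μ : Measure α} [IsFiniteMeasure μ]

/-- A nearly singular kernel integral of a function of small `L¹` norm is small in `Lᵖ`. -/
theorem exists_pos_eLpNorm_kernel_mul_le_half {K : α → α → ℝ≥0∞}
    {p : ℝ≥0∞} (hp : 1 ≤ p)
    (htr : ∀ ε : ℝ≥0∞, ε ≠ 0 → ∃ Λ : ℝ≥0∞, Λ ≠ ∞ ∧ ∃ K₂ : α → α → ℝ≥0∞,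
      Measurable (Function.uncurry K₂) ∧ (∀ x y, K x y ≤ Λ + K₂ x y) ∧
      (∀ᵐ x ∂μ, ∫⁻ y, K₂ x y ∂μ ≤ ε) ∧ ∀ᵐ y ∂μ, ∫⁻ x, K₂ x y ∂μ ≤ ε)
    {L : ℝ≥0∞} (hL : L ≠ 0) (hL' : L ≠ ∞) :
    ∃ c : ℝ≥0∞, c ≠ 0 ∧ c ≠ ∞ ∧ ∀ g : α → ℝ≥0∞, AEMeasurable g μ → eLpNorm g p μ ≤ 1 →
      ∫⁻ y, g y ∂μ ≤ c → eLpNorm (fun x => ∫⁻ y, K x y * g y ∂μ) p μ ≤ L / 2 := by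
  obtain ⟨Λ, hΛ, K₂, hK₂, hle, hA, hB⟩ := htr (L / 2 / 2)
    (ENNReal.half_pos (ENNReal.half_pos hL).ne').ne'
  -- The summand `1` keeps `D` nonzero even when `Λ` or `μ` vanishes.
  set D : ℝ≥0∞ := Λ * μ Set.univ ^ (1 / p.toReal) + 1 with hD
  have hD0 : D ≠ 0 := by simp [hD]
  have hDt : D ≠ ∞ := by
    have := ENNReal.rpow_ne_top_of_nonneg (y := 1 / p.toReal) (by positivity)
      (measure_ne_top μ Set.univ)
    finiteness
  refine ⟨L / 2 / 2 / D, ?_, by finiteness, fun g hg hg1 hgc => ?_⟩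
  · exact (ENNReal.div_pos (ENNReal.half_pos (ENNReal.half_pos hL).ne').ne' hDt).ne'
  have hm : AEStronglyMeasurable (fun x => ∫⁻ y, K₂ x y * g y ∂μ) μ :=
    (aemeasurable_kernel_mul (μ := μ) hK₂ hg).lintegral_prod_right'.aestronglyMeasurable
  calc eLpNorm (fun x => ∫⁻ y, K x y * g y ∂μ) p μ
      ≤ eLpNorm ((fun _ => Λ * ∫⁻ y, g y ∂μ) + fun x => ∫⁻ y, K₂ x y * g y ∂μ) p μ := by
        refine eLpNorm_mono_enorm fun x => ?_
        simp only [enorm_eq_self, Pi.add_apply]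
        rw [← lintegral_const_mul'' _ hg, ← lintegral_add_left' (hg.const_mul _)]
        refine lintegral_mono fun y => ?_
        rw [← add_mul]
        gcongr
        exact hle x y
    _ ≤ eLpNorm (fun _ => Λ * ∫⁻ y, g y ∂μ) p μ + eLpNorm (fun x => ∫⁻ y, K₂ x y * g y ∂μ) p μ :=
        eLpNorm_add_le aestronglyMeasurable_const hm hp
    _ ≤ L / 2 / 2 + L / 2 / 2 := by
        gcongr
        · rcases eq_or_ne μ 0 with h0 | h0
          · simp [h0]
          rw [eLpNorm_const _ (by positivity) h0, enorm_eq_self]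
          calc Λ * (∫⁻ y, g y ∂μ) * μ Set.univ ^ (1 / p.toReal)
              ≤ Λ * (L / 2 / 2 / D) * μ Set.univ ^ (1 / p.toReal) := by gcongr
            _ = (Λ * μ Set.univ ^ (1 / p.toReal)) * (L / 2 / 2 / D) := by ring
            _ ≤ D * (L / 2 / 2 / D) := by gcongr; exact le_self_add
            _ = L / 2 / 2 := ENNReal.mul_div_cancel hD0 hDt
        -- Both Schur bounds equal `L / 4`, so the exponents `1/p` and `1 - 1/p` recombine to `L /
        -- 4`.
        · refine (eLpNorm_kernel_mul_le hp hK₂ hg hA hB).trans ?_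
          have h1 := one_div_toReal_le_one hp
          rw [← ENNReal.rpow_add_of_nonneg _ _ (by positivity) (by linarith)]
          simpa using mul_le_mul_right hg1 (L / 2 / 2)
    _ = L / 2 := ENNReal.add_halves _

end UniformGap

/-! ### The strict inequality for general vector kernels -/

section StrictGap

theorem rpow_lt_of_rpow_add_le {p : ℝ} (hp : 0 < p) {L κ : ℝ≥0∞} (hL : L ≠ 0) (hL' : L ≠ ∞)
    (hκ : κ ≠ 0) : (L ^ p - κ) ^ (1 / p) < L := by
  have h0 : L ^ p ≠ 0 := by simp [ENNReal.rpow_eq_zero_iff, hL, hL']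
  have ht : L ^ p ≠ ∞ := ENNReal.rpow_ne_top_of_nonneg hp.le hL'
  calc (L ^ p - κ) ^ (1 / p) < (L ^ p) ^ (1 / p) :=
        ENNReal.rpow_lt_rpow (ENNReal.sub_lt_self ht h0 hκ) (by positivity)
    _ = L := by rw [← ENNReal.rpow_mul, mul_one_div_cancel hp.ne', ENNReal.rpow_one]

theorem eLpNorm_ofReal_rpow {α F : Type*} [MeasurableSpace α] {μ : Measure α} [ENorm F] {p : ℝ}
    (hp : 0 < p) (f : α → F) :
    eLpNorm f (ENNReal.ofReal p) μ ^ p = ∫⁻ x, ‖f x‖ₑ ^ p ∂μ := by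
  rw [eLpNorm_eq_lintegral_rpow_enorm_toReal (by simpa using hp) (by simp),
    ENNReal.toReal_ofReal hp.le, ← ENNReal.rpow_mul, one_div_mul_cancel hp.ne', ENNReal.rpow_one]

theorem measurable_cauchySchwarzDefect_kernel {α E : Type*} [MeasurableSpace α]
    [NormedAddCommGroup E] [InnerProductSpace ℝ E] {v : α → α → E}
    (hv : StronglyMeasurable (Function.uncurry v)) :
    Measurable fun z : α × (α × α) => cauchySchwarzDefect (v z.1 z.2.1) (v z.1 z.2.2) := by
  have h1 : StronglyMeasurable fun z : α × (α × α) => v z.1 z.2.1 :=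
    hv.comp_measurable (g := fun z : α × (α × α) => (z.1, z.2.1)) (by fun_prop)
  have h2 : StronglyMeasurable fun z : α × (α × α) => v z.1 z.2.2 :=
    hv.comp_measurable (g := fun z : α × (α × α) => (z.1, z.2.2)) (by fun_prop)
  have h3 : Measurable fun z : α × (α × α) => inner ℝ (v z.1 z.2.1) (v z.1 z.2.2) :=
    (h1.inner h2).measurable
  exact (h1.norm.measurable.mul h2.norm.measurable).sub h3.abs

variable {α E : Type*} [MeasurableSpace α] {μ : Measure α} [IsFiniteMeasure μ]
  [NormedAddCommGroup E] [InnerProductSpace ℝ E] [CompleteSpace E]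

/-- The case of large `L¹` mass: a loss in `p`-th powers that does not depend on `f`. -/
theorem exists_pos_lintegral_rpow_add_le (hμ : μ ≠ 0) {v : α → α → E}
    (hv : StronglyMeasurable (Function.uncurry v)) {p : ℝ} (hp : 1 < p) {A : ℝ≥0∞} (hA' : A ≠ ∞)
    (hA : ∀ᵐ x ∂μ, ∫⁻ y, ‖v x y‖ₑ ∂μ ≤ A)
    (hdef : ∀ᵐ z ∂μ.prod (μ.prod μ), 0 < cauchySchwarzDefect (v z.1 z.2.1) (v z.1 z.2.2))
    {c : ℝ≥0∞} (hc : c ≠ 0) (hc' : c ≠ ∞) :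
    ∃ κ : ℝ≥0∞, κ ≠ 0 ∧ ∀ f : α → ℝ, AEStronglyMeasurable f μ → ∫⁻ y, ‖f y‖ₑ ^ p ∂μ ≤ 1 →
      c ≤ ∫⁻ y, ‖f y‖ₑ ∂μ → (∀ᵐ x ∂μ, ∫⁻ y, ‖v x y‖ₑ * ‖f y‖ₑ ∂μ < ∞) →
      ∫⁻ x, ‖∫ y, f y • v x y ∂μ‖ₑ ^ p ∂μ + κ ≤ ∫⁻ x, (∫⁻ y, ‖v x y‖ₑ * ‖f y‖ₑ ∂μ) ^ p ∂μ := by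
  have hp0 : 0 < p := by linarith
  obtain ⟨M, hM, hmin⟩ := exists_pos_half_le_lintegral_min (μ := μ) hp hc hc'
  set C : α × (α × α) → ℝ≥0∞ := fun z =>
    ENNReal.ofReal (cauchySchwarzDefect (v z.1 z.2.1) (v z.1 z.2.2)) with hC
  have hCm : Measurable C :=
    (measurable_cauchySchwarzDefect_kernel hv).ennreal_ofReal
  have hCpos : ∀ᵐ z ∂μ.prod (μ.prod μ), 0 < C z := by
    filter_upwards [hdef] with z hz
    simpa [hC] using hz
  have hU : μ Set.univ ≠ 0 := by simpa using hμ
  have hUt : μ Set.univ ≠ ∞ := measure_ne_top _ _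
  -- Applied on triples `(x, y, z)` to `ψ = φ(y) φ(z)`: the cutoffs have mass at least `c / 2` each,
  -- and `x` contributes the factor `μ Set.univ`.
  obtain ⟨κ, hκ, hκle⟩ := exists_pos_le_lintegral_mul hCm hCpos
    (M := ENNReal.ofReal M * ENNReal.ofReal M) (m := μ Set.univ * (c / 2 * (c / 2)))
    (by finiteness) (by simp [hU, hc]) (by finiteness)
  set A' : ℝ := A.toReal + 1 with hA'def
  have hA'0 : 0 < A' := by positivity
  set r : ℝ≥0∞ := ENNReal.ofReal (2 * M * A')⁻¹ with hr
  have hr0 : r ≠ 0 := by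
    rw [hr, Ne, ENNReal.ofReal_eq_zero, not_le]; positivity
  have hUp : μ Set.univ ^ (p - 1) ≠ ∞ := ENNReal.rpow_ne_top_of_nonneg (by linarith) hUt
  -- The pointwise loss `δ` has integral at least `r * κ`; Jensen's inequality `(∫ δ)^p ≤
  -- μ(univ)^(p-1) ∫ δ^p` gives the constant.
  refine ⟨(r * κ) ^ p / μ Set.univ ^ (p - 1), ?_, fun f hf hf1 hcf hfin => ?_⟩
  · refine (ENNReal.div_pos ?_ hUp).ne'
    rw [Ne, ENNReal.rpow_eq_zero_iff]
    simp [hr0, hκ, hp0, hp0.le]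
  set φ : α → ℝ≥0∞ := fun y => ENNReal.ofReal (min |f y| M) with hφ
  have hφm : AEMeasurable φ μ := by
    have := hf.aemeasurable
    fun_prop
  have hψm : AEMeasurable (fun z : α × (α × α) => φ z.2.1 * φ z.2.2) (μ.prod (μ.prod μ)) :=
    (hφm.comp_fst (ν := μ)|>.mul hφm.comp_snd).comp_snd
  have hψ2 : AEMeasurable (fun w : α × α => φ w.1 * φ w.2) (μ.prod μ) :=
    hφm.comp_fst.mul hφm.comp_snd
  have hφM : ∀ y, φ y ≤ ENNReal.ofReal M := fun y =>
    ENNReal.ofReal_le_ofReal (min_le_right _ _)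
  set δ : α → ℝ≥0∞ := fun x => r * ∫⁻ w, C (x, w) * (φ w.1 * φ w.2) ∂μ.prod μ with hδ
  have hIm : AEMeasurable (fun x => ∫⁻ w, C (x, w) * (φ w.1 * φ w.2) ∂μ.prod μ) μ :=
    (hCm.aemeasurable.mul hψm).lintegral_prod_right'
  have hδm : AEMeasurable δ μ :=
    hIm.const_mul r
  have hδint : r * κ ≤ ∫⁻ x, δ x ∂μ := by
    simp only [hδ]
    rw [lintegral_const_mul'' _ hIm]
    gcongr
    have h := hκle (fun z => φ z.2.1 * φ z.2.2) hψm (fun z => mul_le_mul' (hφM _) (hφM _)) ?_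
    · exact h.trans_eq (lintegral_prod (fun z => C z * (φ z.2.1 * φ z.2.2))
        (hCm.aemeasurable.mul hψm))
    · rw [lintegral_prod _ hψm]
      simp only [lintegral_prod_mul hφm hφm, lintegral_const]
      rw [mul_comm]
      have := hmin f hf hf1 hcf
      gcongr
  have hδp : (r * κ) ^ p / μ Set.univ ^ (p - 1) ≤ ∫⁻ x, δ x ^ p ∂μ := by
    refine ENNReal.div_le_of_le_mul' ?_
    have h := rpow_lintegral_kernel_mul_le hp (k := fun _ : α => 1) measurable_const hδm
    simp only [one_mul, lintegral_one] at h
    refine le_trans ?_ h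
    gcongr
  have hpt : ∀ᵐ x ∂μ, ‖∫ y, f y • v x y ∂μ‖ₑ ^ p + δ x ^ p
      ≤ (∫⁻ y, ‖v x y‖ₑ * ‖f y‖ₑ ∂μ) ^ p := by
    filter_upwards [hA, hfin] with x hxA hxf
    -- Superadditivity of `t ↦ t^p` reduces the claim to the loss at first power.
    refine (ENNReal.add_rpow_le_rpow_add _ _ hp.le).trans ?_
    gcongr
    have hvx : StronglyMeasurable (v x) := hv.comp_measurable measurable_prodMk_left
    have hvi : Integrable (v x) μ :=
      ⟨hvx.aestronglyMeasurable, lt_of_le_of_lt hxA hA'.lt_top⟩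
    have hfvi : Integrable (fun y => f y • v x y) μ := by
      refine ⟨hf.smul hvx.aestronglyMeasurable, ?_⟩
      rw [hasFiniteIntegral_iff_enorm]
      simpa only [enorm_smul, mul_comm] using hxf
    have hle : ∫ y, ‖v x y‖ ∂μ ≤ A' := by
      rw [integral_norm_eq_lintegral_enorm hvi.1]
      exact (ENNReal.toReal_mono hA' hxA).trans (by simp [hA'def])
    refine le_trans (le_of_eq ?_) (norm_integral_add_defect_le hM hA'0 hf hvi hfvi hle)
    congr 1
    exact congrArg (r * ·) (lintegral_prod (fun w => C (x, w) * (φ w.1 * φ w.2))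
      ((hCm.comp measurable_prodMk_left).aemeasurable.mul hψ2))
  calc _ ≤ ∫⁻ x, ‖∫ y, f y • v x y ∂μ‖ₑ ^ p ∂μ + ∫⁻ x, δ x ^ p ∂μ := by gcongr
    _ = ∫⁻ x, (‖∫ y, f y • v x y ∂μ‖ₑ ^ p + δ x ^ p) ∂μ := by
        rw [lintegral_add_right' _ (hδm.pow_const p)]
    _ ≤ _ := lintegral_mono_ae hpt

/-- The vector kernel operator has norm strictly less than the operator whose kernel is its norm,
provided that the kernel does not have constant direction and is not too singular. -/
theorem exists_lt_eLpNorm_integral_smul_le (hμ : μ ≠ 0) {v : α → α → E}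
    (hv : StronglyMeasurable (Function.uncurry v)) {p : ℝ} (hp : 1 < p) {A : ℝ≥0∞} (hA' : A ≠ ∞)
    (hA : ∀ᵐ x ∂μ, ∫⁻ y, ‖v x y‖ₑ ∂μ ≤ A)
    (hdef : ∀ᵐ z ∂μ.prod (μ.prod μ), 0 < cauchySchwarzDefect (v z.1 z.2.1) (v z.1 z.2.2))
    (htr : ∀ ε : ℝ≥0∞, ε ≠ 0 → ∃ Λ : ℝ≥0∞, Λ ≠ ∞ ∧ ∃ K₂ : α → α → ℝ≥0∞,
      Measurable (Function.uncurry K₂) ∧ (∀ x y, ‖v x y‖ₑ ≤ Λ + K₂ x y) ∧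
      (∀ᵐ x ∂μ, ∫⁻ y, K₂ x y ∂μ ≤ ε) ∧ ∀ᵐ y ∂μ, ∫⁻ x, K₂ x y ∂μ ≤ ε)
    {L : ℝ≥0∞} (hL : L ≠ 0) (hL' : L ≠ ∞)
    (hLle : ∀ f : α → ℝ, MemLp f (ENNReal.ofReal p) μ → eLpNorm f (ENNReal.ofReal p) μ = 1 →
      eLpNorm (fun x => ∫⁻ y, ‖v x y‖ₑ * ‖f y‖ₑ ∂μ) (ENNReal.ofReal p) μ ≤ L) :
    ∃ L' < L, ∀ f : α → ℝ, MemLp f (ENNReal.ofReal p) μ → eLpNorm f (ENNReal.ofReal p) μ = 1 →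
      eLpNorm (fun x => ∫ y, f y • v x y ∂μ) (ENNReal.ofReal p) μ ≤ L' := by
  have hp0 : 0 < p := by linarith
  have hP : 1 ≤ ENNReal.ofReal p := by simpa using hp.le
  obtain ⟨c, hc, hc', hsmall⟩ := exists_pos_eLpNorm_kernel_mul_le_half hP htr hL hL'
  obtain ⟨κ, hκ, hbig⟩ := exists_pos_lintegral_rpow_add_le hμ hv hp hA' hA hdef hc hc'
  refine ⟨max (L / 2) ((L ^ p - κ) ^ (1 / p)), max_lt (ENNReal.half_lt_self hL hL')
    (rpow_lt_of_rpow_add_le hp0 hL hL' hκ), fun f hf hf1 => ?_⟩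
  have hg : AEMeasurable (fun y => ‖f y‖ₑ) μ := hf.1.enorm
  rcases le_total (∫⁻ y, ‖f y‖ₑ ∂μ) c with h | h
  · refine le_trans ?_ ((hsmall _ hg (by simpa using hf1.le) h).trans (le_max_left _ _))
    refine eLpNorm_mono_enorm fun x => ?_
    refine (enorm_integral_le_lintegral_enorm _).trans (le_of_eq ?_)
    simp only [enorm_smul, mul_comm, enorm_eq_self]
  · have hK : Measurable (Function.uncurry fun x y => ‖v x y‖ₑ) := hv.enorm
    have hm : AEMeasurable (fun x => ∫⁻ y, ‖v x y‖ₑ * ‖f y‖ₑ ∂μ) μ :=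
      (aemeasurable_kernel_mul (μ := μ) hK hg).lintegral_prod_right'
    have hle := hLle f hf hf1
    have hfin := ae_lt_top_of_eLpNorm_lt_top (by simpa using hp0) hm (hle.trans_lt hL'.lt_top)
    have hfp : ∫⁻ y, ‖f y‖ₑ ^ p ∂μ ≤ 1 := by
      rw [← eLpNorm_ofReal_rpow hp0, hf1, ENNReal.one_rpow]
    have h1 := hbig f hf.1 hfp h hfin
    have h2 : ∫⁻ x, (∫⁻ y, ‖v x y‖ₑ * ‖f y‖ₑ ∂μ) ^ p ∂μ ≤ L ^ p := by
      have := eLpNorm_ofReal_rpow (μ := μ) hp0 (fun x => ∫⁻ y, ‖v x y‖ₑ * ‖f y‖ₑ ∂μ)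
      simp only [enorm_eq_self] at this
      rw [← this]
      gcongr
    have hκt : κ ≠ ∞ := by
      rintro rfl
      have := h1.trans h2
      rw [add_top, top_le_iff] at this
      exact ENNReal.rpow_ne_top_of_nonneg hp0.le hL' this
    have h3 := ENNReal.le_sub_of_add_le_right hκt (h1.trans h2)
    rw [← eLpNorm_ofReal_rpow hp0] at h3
    refine le_trans ?_ (le_max_right _ _)
    calc eLpNorm (fun x => ∫ y, f y • v x y ∂μ) (ENNReal.ofReal p) μ
        = (eLpNorm (fun x => ∫ y, f y • v x y ∂μ) (ENNReal.ofReal p) μ ^ p) ^ (1 / p) := by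
          rw [← ENNReal.rpow_mul, mul_one_div_cancel hp0.ne', ENNReal.rpow_one]
      _ ≤ _ := by gcongr

end StrictGap

/-! ### Size and direction of the gradient kernel -/

section Kernel

variable {n : ℕ}

theorem sq_bracket {x y : Space n} :
    bracket x y ^ 2 = ‖x - y‖ ^ 2 + (1 - ‖x‖ ^ 2) * (1 - ‖y‖ ^ 2) := by
  unfold bracket
  split_ifs with h
  · simp [h]
  · have hy : ‖y‖ ≠ 0 := norm_ne_zero_iff.2 h
    rw [norm_sub_sq_real, norm_sub_sq_real, norm_smul, norm_smul, real_inner_smul_left,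
      real_inner_smul_right, norm_norm, norm_inv, norm_norm]
    field_simp
    ring

theorem bracket_nonneg (x y : Space n) : 0 ≤ bracket x y := by
  unfold bracket
  split_ifs <;> positivity

theorem norm_sub_lt_bracket {x y : Space n} (hx : ‖x‖ < 1) (hy : ‖y‖ < 1) :
    ‖x - y‖ < bracket x y := by
  refine lt_of_pow_lt_pow_left₀ 2 (bracket_nonneg x y) ?_
  rw [sq_bracket]
  have h1 : 0 < 1 - ‖x‖ ^ 2 := by nlinarith [norm_nonneg x]
  have h2 : 0 < 1 - ‖y‖ ^ 2 := by nlinarith [norm_nonneg y]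
  nlinarith [mul_pos h1 h2]

/-- Factor `|y|` out of `|y|² x - y`. This cancels one power of the bracket in the second term of
the kernel. -/
theorem norm_sq_smul_sub (x y : Space n) : ‖‖y‖ ^ 2 • x - y‖ = ‖y‖ * bracket x y := by
  unfold bracket
  split_ifs with h
  · simp [h]
  · have hy : ‖y‖ ≠ 0 := norm_ne_zero_iff.2 h
    rw [← norm_norm y, ← norm_smul, norm_norm, smul_sub, smul_smul, smul_smul,
      mul_inv_cancel₀ hy, one_smul, sq]

theorem inv_pow_mul_self {d : ℝ} (hd : d ≠ 0) (hn : 0 < n) : (d ^ n)⁻¹ * d = (d ^ (n - 1))⁻¹ := by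
  obtain ⟨m, rfl⟩ := Nat.exists_eq_add_one_of_ne_zero hn.ne'
  rw [Nat.add_sub_cancel, pow_succ, mul_inv, inv_mul_cancel_right₀ hd]

theorem enorm_gradKernel_le (hn : 1 < n) {x y : Space n} (hx : ‖x‖ < 1) (hy : ‖y‖ < 1) :
    ‖gradKernel x y‖ₑ ≤ 2 * (‖x - y‖ₑ ^ (n - 1))⁻¹ := by
  -- On the diagonal the right side is `∞`, because `n - 1 > 0`.
  rcases eq_or_ne x y with rfl | hxy
  · rw [sub_self, enorm_zero, zero_pow (by omega), ENNReal.inv_zero, ENNReal.mul_top (by simp)]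
    exact le_top
  have hd : 0 < ‖x - y‖ := norm_sub_pos_iff.2 hxy
  have hlt := norm_sub_lt_bracket hx hy
  have hb : 0 < bracket x y := hd.trans hlt
  have h3 : (bracket x y ^ (n - 1))⁻¹ ≤ (‖x - y‖ ^ (n - 1))⁻¹ := by gcongr
  have h4 : ‖y‖ * (bracket x y ^ (n - 1))⁻¹ ≤ 1 * (‖x - y‖ ^ (n - 1))⁻¹ := by gcongr
  have h5 : ‖gradKernel x y‖ ≤ 2 * (‖x - y‖ ^ (n - 1))⁻¹ := by
    unfold gradKernel
    refine (norm_sub_le _ _).trans ?_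
    rw [norm_smul, norm_smul, norm_sq_smul_sub, norm_inv, norm_inv, norm_pow, norm_norm, norm_pow,
      Real.norm_of_nonneg hb.le, inv_pow_mul_self hd.ne' (by omega), mul_left_comm,
      inv_pow_mul_self hb.ne' (by omega)]
    linarith
  refine (ofReal_norm (gradKernel x y)).symm.trans_le ((ENNReal.ofReal_le_ofReal h5).trans_eq ?_)
  rw [ENNReal.ofReal_mul (by norm_num), ENNReal.ofReal_inv_of_pos (by positivity),
    ENNReal.ofReal_pow hd.le, ofReal_norm, ENNReal.ofReal_ofNat]

theorem measurable_bracket : Measurable fun z : Space n × Space n => bracket z.1 z.2 := by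
  unfold bracket
  refine Measurable.ite (measurableSet_eq_fun measurable_snd measurable_const) measurable_const ?_
  fun_prop

theorem measurable_gradKernel :
    Measurable (Function.uncurry fun x y : Space n => gradKernel x y) := by
  have := measurable_bracket (n := n)
  simp only [Function.uncurry_def, gradKernel]
  fun_prop

/-- The coefficient `b = |x - y|^(-n) - [x, y]^(-n)` is positive by `norm_sub_lt_bracket`; the value
of `a` plays no role. -/
theorem gradKernel_eq_smul_sub_smul {x y : Space n} (hx : ‖x‖ < 1) (hy : ‖y‖ < 1) (hxy : x ≠ y) :
    ∃ a b : ℝ, 0 < b ∧ gradKernel x y = a • x - b • y := by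
  rcases Nat.eq_zero_or_pos n with rfl | hn
  · exact absurd (Subsingleton.elim x y) hxy
  have hd : 0 < ‖x - y‖ := norm_sub_pos_iff.2 hxy
  have hlt := norm_sub_lt_bracket hx hy
  refine ⟨(‖x - y‖ ^ n)⁻¹ - (bracket x y ^ n)⁻¹ * ‖y‖ ^ 2, (‖x - y‖ ^ n)⁻¹ - (bracket x y ^ n)⁻¹,
    ?_, ?_⟩
  · rw [sub_pos]
    gcongr
  · unfold gradKernel
    module

theorem cauchySchwarzDefect_pos_of_linearIndependent {E : Type*} [NormedAddCommGroup E]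
    [InnerProductSpace ℝ E] {a b : E} (h : LinearIndependent ℝ ![a, b]) :
    0 < cauchySchwarzDefect a b := by
  refine (cauchySchwarzDefect_nonneg a b).lt_of_ne fun h0 => ?_
  have h1 : ‖inner ℝ a b‖ = ‖a‖ * ‖b‖ := by
    rw [Real.norm_eq_abs]; unfold cauchySchwarzDefect at h0; linarith
  rcases ((norm_inner_eq_norm_tfae ℝ a b).out 0 2).1 h1 with ha | ⟨r, hr⟩
  · exact h.ne_zero 0 (by simpa using ha)
  · rw [LinearIndependent.pair_iff] at h
    have := h r (-1) (by simp [hr])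
    norm_num at this

theorem cauchySchwarzDefect_gradKernel_pos {x y z : Space n} (hx : ‖x‖ < 1) (hy : ‖y‖ < 1)
    (hz : ‖z‖ < 1) (h : LinearIndependent ℝ ![z, y, x]) :
    0 < cauchySchwarzDefect (gradKernel x y) (gradKernel x z) := by
  have hxy : x ≠ y := fun e => by
    have := h.injective (a₁ := 2) (a₂ := 1) (by simpa using e)
    simp at this
  have hxz : x ≠ z := fun e => by
    have := h.injective (a₁ := 2) (a₂ := 0) (by simpa using e)
    simp at this
  obtain ⟨a, b, hb, e1⟩ := gradKernel_eq_smul_sub_smul hx hy hxy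
  obtain ⟨c, d, hd, e2⟩ := gradKernel_eq_smul_sub_smul hx hz hxz
  refine cauchySchwarzDefect_pos_of_linearIndependent ?_
  rw [LinearIndependent.pair_iff]
  intro s t hst
  rw [e1, e2] at hst
  -- The coefficients of `z`, `y`, `x` in `s (a x - b y) + t (c x - d z)`.
  have := Fintype.linearIndependent_iff.1 h ![-(t * d), -(s * b), s * a + t * c] (by
    simp only [Fin.sum_univ_three, Matrix.cons_val_zero, Matrix.cons_val_one, Matrix.cons_val]
    rw [← hst]
    module)
  have h1 := this 1
  have h2 := this 0
  simp only [Matrix.cons_val_one, Matrix.cons_val_zero, neg_eq_zero,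
    mul_eq_zero, hb.ne', hd.ne', or_false] at h1 h2
  exact ⟨h1, h2⟩

theorem lintegral_inv_enorm_pow_ne_top (hn : 1 < n) (r : ℝ) :
    ∫⁻ z in ball (0 : Space n) r, 2 * (‖z‖ₑ ^ (n - 1))⁻¹ ≠ ∞ := by
  have hfr : Module.finrank ℝ (Space n) = n := by simp
  have : Nontrivial (Space n) := Module.nontrivial_of_finrank_pos (R := ℝ) (by omega)
  have hi : IntegrableOn (fun z : Space n => (‖z‖ ^ (n - 1))⁻¹) (ball 0 r) := by
    refine integrableOn_ball_of_norm_le_rpow (α := ((n - 1 : ℕ) : ℝ)) (C := 1) (by omega) ?_ ?_ ?_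
    · rw [hfr]; exact_mod_cast (by omega : n - 1 < n)
    · refine .of_forall fun z => ?_
      rw [one_mul, Real.rpow_neg (norm_nonneg _), Real.rpow_natCast, norm_inv, norm_pow, norm_norm]
    · exact Measurable.aestronglyMeasurable (by fun_prop)
  have h2 := hi.2
  rw [hasFiniteIntegral_iff_enorm] at h2
  rw [lintegral_const_mul _ (by fun_prop)]
  refine ENNReal.mul_ne_top (by simp) (ne_of_lt (lt_of_le_of_lt (lintegral_mono_ae ?_) h2))
  -- At `0` the inverse is `∞` in `ℝ≥0∞` but `0` in `ℝ`; elsewhere the integrands agree.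
  have h0 : ∀ᵐ z : Space n, z ≠ 0 := by simp [ae_iff]
  filter_upwards [ae_restrict_of_ae h0] with z hz
  rw [enorm_inv (pow_ne_zero _ (norm_ne_zero_iff.2 hz)), enorm_pow, enorm_norm]

/-- Translation and reflection invariance; differences of points of the unit ball lie in the ball of
radius `2`. -/
theorem setLIntegral_comp_sub_le {W : Space n → ℝ≥0∞} {x : Space n} (hx : ‖x‖ < 1) :
    ∫⁻ y, W (x - y) ∂ballMeasure n ≤ ∫⁻ z in ball (0 : Space n) 2, W z := by
  rw [ballMeasure, ← lintegral_indicator measurableSet_ball,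
    ← lintegral_indicator measurableSet_ball,
    ← lintegral_sub_left_eq_self (fun z => (ball (0 : Space n) 2).indicator W z) x]
  refine lintegral_mono fun y => ?_
  by_cases hy : y ∈ ball (0 : Space n) 1
  · rw [Set.indicator_of_mem hy, Set.indicator_of_mem]
    rw [mem_ball_zero_iff] at hy ⊢
    linarith [norm_sub_le x y]
  · simp [Set.indicator_of_notMem hy]

theorem setLIntegral_comp_sub_right_le {W : Space n → ℝ≥0∞} {y : Space n} (hy : ‖y‖ < 1) :
    ∫⁻ x, W (x - y) ∂ballMeasure n ≤ ∫⁻ z in ball (0 : Space n) 2, W z := by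
  rw [ballMeasure, ← lintegral_indicator measurableSet_ball,
    ← lintegral_indicator measurableSet_ball,
    ← lintegral_sub_right_eq_self (fun z => (ball (0 : Space n) 2).indicator W z) y]
  refine lintegral_mono fun x => ?_
  by_cases hx : x ∈ ball (0 : Space n) 1
  · rw [Set.indicator_of_mem hx, Set.indicator_of_mem]
    rw [mem_ball_zero_iff] at hx ⊢
    linarith [norm_sub_le x y]
  · simp [Set.indicator_of_notMem hx]

instance isFiniteMeasure_ballMeasure (n : ℕ) : IsFiniteMeasure (ballMeasure n) :=
  ⟨by rw [ballMeasure, Measure.restrict_apply_univ]; exact measure_ball_lt_top⟩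

theorem ballMeasure_ne_zero (n : ℕ) : ballMeasure n ≠ 0 := by
  rw [ballMeasure, Ne, Measure.restrict_eq_zero]
  exact (measure_ball_pos _ _ one_pos).ne'

theorem ae_ballMeasure_norm_lt (n : ℕ) : ∀ᵐ x ∂ballMeasure n, ‖x‖ < 1 := by
  filter_upwards [ae_restrict_mem measurableSet_ball] with x hx
  simpa using hx

/-- Kernels dominated on the ball by a convolution kernel that is integrable near the origin split
into a bounded part and a part with small Schur bounds. -/
theorem exists_kernel_split {K : Space n → Space n → ℝ≥0∞}
    (hK : Measurable (Function.uncurry K)) {W : Space n → ℝ≥0∞}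
    (hWm : Measurable W) (hW : ∫⁻ z in ball (0 : Space n) 2, W z ≠ ∞)
    (hKW : ∀ x y : Space n, ‖x‖ < 1 → ‖y‖ < 1 → K x y ≤ W (x - y)) {ε : ℝ≥0∞} (hε : ε ≠ 0) :
    ∃ Λ : ℝ≥0∞, Λ ≠ ∞ ∧ ∃ K₂ : Space n → Space n → ℝ≥0∞,
      Measurable (Function.uncurry K₂) ∧ (∀ x y, K x y ≤ Λ + K₂ x y) ∧
      (∀ᵐ x ∂ballMeasure n, ∫⁻ y, K₂ x y ∂ballMeasure n ≤ ε) ∧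
      ∀ᵐ y ∂ballMeasure n, ∫⁻ x, K₂ x y ∂ballMeasure n ≤ ε := by
  set ν := volume.restrict (ball (0 : Space n) 2) with hν
  obtain ⟨δ, hδ, hsmall⟩ := exists_pos_setLIntegral_lt_of_measure_lt hW hε
  -- By Markov's inequality this height makes `{Λ < W}` smaller than `δ`, so absolute continuity
  -- bounds the integral of `W` there by `ε`.
  obtain ⟨Λ, hΛ, hΛt⟩ : ∃ Λ : ℝ≥0∞, (∫⁻ z, W z ∂ν) / δ < Λ ∧ Λ < ∞ :=
    exists_between (ENNReal.div_lt_top hW hδ.ne')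
  have hΛ0 : Λ ≠ 0 := (zero_le.trans_lt hΛ).ne'
  have hmeas : ν {z | Λ < W z} < δ := by
    refine lt_of_le_of_lt (measure_mono fun z hz => le_of_lt (Set.mem_ofPred.1 hz)) ?_
    refine lt_of_le_of_lt (meas_ge_le_lintegral_div hWm.aemeasurable hΛ0 hΛt.ne) ?_
    exact ENNReal.div_lt_of_lt_mul' ((ENNReal.div_lt_iff (.inl hδ.ne') (.inr hW)).1 hΛ)
  have hS : MeasurableSet {z | Λ < W z} := measurableSet_lt measurable_const hWm
  have hint : ∫⁻ z, {z | Λ < W z}.indicator W z ∂ν ≤ ε := by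
    rw [lintegral_indicator hS]
    exact (hsmall _ hmeas).le
  have hKS : MeasurableSet {q : Space n × Space n | Λ < Function.uncurry K q} :=
    measurableSet_lt measurable_const hK
  have hdom : ∀ x y : Space n, ‖x‖ < 1 → ‖y‖ < 1 →
      {q | Λ < Function.uncurry K q}.indicator (Function.uncurry K) (x, y)
        ≤ {z | Λ < W z}.indicator W (x - y) := by
    intro x y hx hy
    by_cases h : Λ < K x y
    · rw [Set.indicator_of_mem (by exact h), Set.indicator_of_mem
        (by exact h.trans_le (hKW x y hx hy))]
      exact hKW x y hx hy
    · rw [Set.indicator_of_notMem (by exact h)]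
      exact zero_le
  refine ⟨Λ, hΛt.ne, fun x y => {q | Λ < Function.uncurry K q}.indicator (Function.uncurry K) (x, y),
    hK.indicator hKS, fun x y => ?_, ?_, ?_⟩
  · by_cases h : Λ < K x y
    · simp only
      rw [Set.indicator_of_mem (by exact h)]
      exact le_add_self
    · exact (not_lt.1 h).trans le_self_add
  · filter_upwards [ae_ballMeasure_norm_lt n] with x hx
    refine (lintegral_mono_ae ?_).trans ((setLIntegral_comp_sub_le hx).trans hint)
    filter_upwards [ae_ballMeasure_norm_lt n] with y hy using hdom x y hx hy
  · filter_upwards [ae_ballMeasure_norm_lt n] with y hy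
    refine (lintegral_mono_ae ?_).trans ((setLIntegral_comp_sub_right_le hy).trans hint)
    filter_upwards [ae_ballMeasure_norm_lt n] with x hx using hdom x y hx hy

theorem ae_ballMeasure_notMem_span {m : ℕ} (hm : m < n) (b : Fin m → Space n) :
    ∀ᵐ z ∂ballMeasure n, z ∉ Submodule.span ℝ (Set.range b) := by
  refine ae_restrict_of_ae ?_
  have h : Submodule.span ℝ (Set.range b) ≠ ⊤ := by
    intro h
    have h1 := finrank_range_le_card (R := ℝ) b
    rw [Set.finrank, h, finrank_top] at h1
    simp at h1
    omega
  rw [ae_iff]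
  simpa using Measure.addHaar_submodule volume _ h

/-- Each new vector avoids the span of the earlier ones, a proper subspace and so a null set; for
the third vector this needs `n > 2`. -/
theorem ae_ae_ae_linearIndependent (hn : 2 < n) :
    ∀ᵐ x ∂ballMeasure n, ∀ᵐ y ∂ballMeasure n, ∀ᵐ z ∂ballMeasure n,
      LinearIndependent ℝ ![z, y, x] := by
  filter_upwards [ae_ballMeasure_notMem_span (by omega) ![]] with x hx
  filter_upwards [ae_ballMeasure_notMem_span (by omega) ![x]] with y hy
  filter_upwards [ae_ballMeasure_notMem_span (by omega) ![y, x]] with z hz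
  refine linearIndependent_finCons.2 ⟨linearIndependent_finCons.2
    ⟨linearIndependent_finCons.2 ⟨linearIndependent_empty_type, hx⟩, hy⟩, hz⟩

end Kernel

/-! ### Integral operators on the ball and their norms -/

section Operators

theorem eLpNorm_lintegral_enorm_mul_le {n : ℕ} {F : Type*} [NormedAddCommGroup F]
    {k : Space n → Space n → F} {p A B : ℝ≥0∞} {f : Space n → ℝ}
    (hk : StronglyMeasurable (Function.uncurry k)) (hp : 1 ≤ p)
    (hA : ∀ᵐ x ∂ballMeasure n, ∫⁻ y, ‖k x y‖ₑ ∂ballMeasure n ≤ A)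
    (hB : ∀ᵐ y ∂ballMeasure n, ∫⁻ x, ‖k x y‖ₑ ∂ballMeasure n ≤ B)
    (hf : AEStronglyMeasurable f (ballMeasure n)) :
    eLpNorm (fun x => ∫⁻ y, ‖k x y‖ₑ * ‖f y‖ₑ ∂ballMeasure n) p (ballMeasure n)
      ≤ B ^ (1 / p.toReal) * A ^ (1 - 1 / p.toReal) * eLpNorm f p (ballMeasure n) := by
  simpa using eLpNorm_kernel_mul_le (K := fun x y => ‖k x y‖ₑ) hp hk.enorm hf.enorm hA hB

variable {n : ℕ} {F : Type*} [NormedAddCommGroup F] [NormedSpace ℝ F]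
  {k : Space n → Space n → F} {p A B : ℝ≥0∞} {f : Space n → ℝ}

theorem sphereArea_pos (hn : 0 < n) : 0 < sphereArea n := by
  have hfr : Module.finrank ℝ (Space n) = n := by simp
  rw [sphereArea, Measure.toSphere_real_apply_univ, hfr]
  have : 0 < (volume : Measure (Space n)).real (ball 0 1) :=
    ENNReal.toReal_pos (measure_ball_pos _ _ one_pos).ne' measure_ball_lt_top.ne
  positivity

theorem integralOp_eq_integral (k : Space n → Space n → F) (f : Space n → ℝ) (x : Space n) :
    integralOp k f x = ∫ y, f y • ((sphereArea n)⁻¹ • k x y) ∂ballMeasure n := by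
  rw [integralOp, ← integral_smul]
  exact integral_congr_ae (.of_forall fun y => smul_comm _ _ _)

theorem integralOp_smul (a : ℝ) : integralOp k (a • f) = a • integralOp k f := by
  ext x
  simp only [integralOp, Pi.smul_apply, smul_eq_mul, mul_smul, integral_smul]
  rw [smul_comm]

theorem eLpNorm_integral_smul_le (k : Space n → Space n → F) (f : Space n → ℝ) (p : ℝ≥0∞) :
    eLpNorm (fun x => ∫ y, f y • k x y ∂ballMeasure n) p (ballMeasure n)
      ≤ eLpNorm (fun x => ∫⁻ y, ‖k x y‖ₑ * ‖f y‖ₑ ∂ballMeasure n) p (ballMeasure n) := by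
  refine eLpNorm_mono_enorm fun x => (enorm_integral_le_lintegral_enorm _).trans (le_of_eq ?_)
  simp only [enorm_smul, mul_comm, enorm_eq_self]

theorem boundedOnLp_of_schur (hk : StronglyMeasurable (Function.uncurry k)) (hp : 1 ≤ p)
    (hA' : A ≠ ∞) (hB' : B ≠ ∞)
    (hA : ∀ᵐ x ∂ballMeasure n, ∫⁻ y, ‖k x y‖ₑ ∂ballMeasure n ≤ A)
    (hB : ∀ᵐ y ∂ballMeasure n, ∫⁻ x, ‖k x y‖ₑ ∂ballMeasure n ≤ B) : BoundedOnLp k p := by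
  have h1 := one_div_toReal_le_one hp
  have hCt : B ^ (1 / p.toReal) * A ^ (1 - 1 / p.toReal) ≠ ∞ :=
    ENNReal.mul_ne_top (ENNReal.rpow_ne_top_of_nonneg (by positivity) hB')
      (ENNReal.rpow_ne_top_of_nonneg (by linarith) hA')
  set C := B ^ (1 / p.toReal) * A ^ (1 - 1 / p.toReal) with hC
  have hle : ∀ f : Space n → ℝ, MemLp f p (ballMeasure n) →
      eLpNorm (integralOp k f) p (ballMeasure n)
        ≤ ‖(sphereArea n)⁻¹‖ₑ * (C * eLpNorm f p (ballMeasure n)) := by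
    intro f hf
    refine (eLpNorm_const_smul_le (f := fun x => ∫ y, f y • k x y ∂ballMeasure n)).trans ?_
    gcongr
    exact (eLpNorm_integral_smul_le k f p).trans (eLpNorm_lintegral_enorm_mul_le hk hp hA hB hf.1)
  refine ⟨fun f hf => ⟨?_, ?_, ?_⟩, ?_⟩
  · have hm : AEMeasurable (fun x => ∫⁻ y, ‖k x y‖ₑ * ‖f y‖ₑ ∂ballMeasure n) (ballMeasure n) :=
      (aemeasurable_kernel_mul (μ := ballMeasure n) (K := fun x y => ‖k x y‖ₑ) hk.enorm
        hf.1.enorm).lintegral_prod_right'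
    have hfin := ae_lt_top_of_eLpNorm_lt_top (zero_lt_one.trans_le hp).ne' hm
      ((eLpNorm_lintegral_enorm_mul_le hk hp hA hB hf.1).trans_lt
        (ENNReal.mul_lt_top hCt.lt_top hf.2))
    filter_upwards [hfin] with x hx
    refine ⟨hf.1.smul (hk.comp_measurable measurable_prodMk_left).aestronglyMeasurable, ?_⟩
    rw [hasFiniteIntegral_iff_enorm]
    simpa only [enorm_smul, mul_comm] using hx
  · have h := (hf.1.comp_snd (μ := ballMeasure n)).smul
      (hk.aestronglyMeasurable (μ := (ballMeasure n).prod (ballMeasure n)))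
    exact h.integral_prod_right'.const_smul _
  · exact (hle f hf).trans_lt
      (ENNReal.mul_lt_top (by simp) (ENNReal.mul_lt_top hCt.lt_top hf.2))
  · refine lt_of_le_of_lt (b := ‖(sphereArea n)⁻¹‖ₑ * C) ?_
      (ENNReal.mul_lt_top (by simp) hCt.lt_top)
    refine iSup_le fun f => iSup_le fun hf => iSup_le fun hf1 => ?_
    simpa [hf1] using hle f hf

/-- Homogeneity reduces to `‖f‖_p = 1`. If `‖f‖_p = 0` there is no normalisation, but then `f = 0`
almost everywhere and the integrals vanish. -/
theorem eLpNorm_le_lpOpNorm (hp : p ≠ 0) (hf : MemLp f p (ballMeasure n)) :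
    eLpNorm (integralOp k f) p (ballMeasure n)
      ≤ lpOpNorm (integralOp k) p * eLpNorm f p (ballMeasure n) := by
  rcases eq_or_ne (eLpNorm f p (ballMeasure n)) 0 with h0 | h0
  · rw [eLpNorm_eq_zero_iff hf.1 hp] at h0
    have : integralOp k f = 0 := by
      ext x
      have : (fun y => f y • k x y) =ᵐ[ballMeasure n] 0 := by
        filter_upwards [h0] with y hy
        simp [hy]
      rw [integralOp, integral_congr_ae this]
      simp
    simp [this]
  set a := (eLpNorm f p (ballMeasure n)).toReal with ha
  have ha0 : 0 < a := ENNReal.toReal_pos h0 hf.2.ne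
  have hae : ‖a‖ₑ = eLpNorm f p (ballMeasure n) := by
    rw [Real.enorm_of_nonneg ha0.le, ha, ENNReal.ofReal_toReal hf.2.ne]
  have h1 : eLpNorm (a⁻¹ • f) p (ballMeasure n) = 1 := by
    rw [eLpNorm_const_smul, enorm_inv ha0.ne', hae, ENNReal.inv_mul_cancel h0 hf.2.ne]
  have h2 : f = a • (a⁻¹ • f) := by rw [smul_inv_smul₀ ha0.ne']
  calc eLpNorm (integralOp k f) p (ballMeasure n)
      = eLpNorm f p (ballMeasure n) * eLpNorm (integralOp k (a⁻¹ • f)) p (ballMeasure n) := by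
        conv_lhs => rw [h2]
        rw [integralOp_smul, eLpNorm_const_smul, hae]
    _ ≤ eLpNorm f p (ballMeasure n) * lpOpNorm (integralOp k) p := by
        gcongr
        exact le_iSup_of_le (a⁻¹ • f) (le_iSup_of_le (hf.const_smul _) (le_iSup_of_le h1 le_rfl))
    _ = _ := mul_comm _ _

theorem lintegral_enorm_smul_mul_eq (x : Space n) (hf0 : 0 ≤ f)
    (hi : Integrable (fun y => f y • ‖k x y‖) (ballMeasure n)) :
    ∫⁻ y, ‖(sphereArea n)⁻¹ • k x y‖ₑ * ‖f y‖ₑ ∂ballMeasure n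
      = ‖integralOp (fun x y => ‖k x y‖) f x‖ₑ := by
  have h0 : 0 ≤ ∫ y, f y • ‖k x y‖ ∂ballMeasure n :=
    integral_nonneg fun y => mul_nonneg (hf0 y) (norm_nonneg _)
  have h1 : ‖∫ y, f y • ‖k x y‖ ∂ballMeasure n‖ₑ
      = ∫⁻ y, ‖k x y‖ₑ * ‖f y‖ₑ ∂ballMeasure n := by
    rw [Real.enorm_of_nonneg h0, ofReal_integral_eq_lintegral_ofReal hi
      (.of_forall fun y => mul_nonneg (hf0 y) (norm_nonneg _))]
    refine lintegral_congr fun y => ?_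
    rw [smul_eq_mul, ENNReal.ofReal_mul (hf0 y), ofReal_norm, Real.enorm_of_nonneg (hf0 y),
      mul_comm]
  rw [integralOp, enorm_smul, h1, ← lintegral_const_mul' _ _ (by simp)]
  simp only [enorm_smul, mul_assoc]

end Operators

/-! ### The operators `𝒟` and `𝒩` -/

section Main

variable {n : ℕ}

theorem stronglyMeasurable_gradKernel :
    StronglyMeasurable (Function.uncurry fun x y : Space n => gradKernel x y) :=
  measurable_gradKernel.stronglyMeasurable

theorem ae_lintegral_gradKernel_le (hn : 1 < n) :
    ∀ᵐ x ∂ballMeasure n, ∫⁻ y, ‖gradKernel x y‖ₑ ∂ballMeasure n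
      ≤ ∫⁻ z in ball (0 : Space n) 2, 2 * (‖z‖ₑ ^ (n - 1))⁻¹ := by
  filter_upwards [ae_ballMeasure_norm_lt n] with x hx
  refine (lintegral_mono_ae ?_).trans
    (setLIntegral_comp_sub_le (W := fun z => 2 * (‖z‖ₑ ^ (n - 1))⁻¹) hx)
  filter_upwards [ae_ballMeasure_norm_lt n] with y hy using enorm_gradKernel_le hn hx hy

theorem ae_lintegral_gradKernel_right_le (hn : 1 < n) :
    ∀ᵐ y ∂ballMeasure n, ∫⁻ x, ‖gradKernel x y‖ₑ ∂ballMeasure n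
      ≤ ∫⁻ z in ball (0 : Space n) 2, 2 * (‖z‖ₑ ^ (n - 1))⁻¹ := by
  filter_upwards [ae_ballMeasure_norm_lt n] with y hy
  refine (lintegral_mono_ae ?_).trans
    (setLIntegral_comp_sub_right_le (W := fun z => 2 * (‖z‖ₑ ^ (n - 1))⁻¹) hy)
  filter_upwards [ae_ballMeasure_norm_lt n] with x hx using enorm_gradKernel_le hn hx hy

theorem boundedOnLp_gradKernel (hn : 1 < n) {p : ℝ≥0∞} (hp : 1 ≤ p) :
    BoundedOnLp (fun x y : Space n => gradKernel x y) p :=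
  boundedOnLp_of_schur stronglyMeasurable_gradKernel hp (lintegral_inv_enorm_pow_ne_top hn 2)
    (lintegral_inv_enorm_pow_ne_top hn 2) (ae_lintegral_gradKernel_le hn)
    (ae_lintegral_gradKernel_right_le hn)

theorem boundedOnLp_norm_gradKernel (hn : 1 < n) {p : ℝ≥0∞} (hp : 1 ≤ p) :
    BoundedOnLp (fun x y : Space n => ‖gradKernel x y‖) p :=
  boundedOnLp_of_schur stronglyMeasurable_gradKernel.norm hp (lintegral_inv_enorm_pow_ne_top hn 2)
    (lintegral_inv_enorm_pow_ne_top hn 2)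
    (by simpa only [enorm_norm] using ae_lintegral_gradKernel_le hn)
    (by simpa only [enorm_norm] using ae_lintegral_gradKernel_right_le hn)

/-- The kernel of `𝒟`, including the factor `1 / ω_{n-1}`. -/
noncomputable def scaledKernel (x y : Space n) : Space n := (sphereArea n)⁻¹ • gradKernel x y

theorem stronglyMeasurable_scaledKernel :
    StronglyMeasurable (Function.uncurry fun x y : Space n => scaledKernel x y) :=
  stronglyMeasurable_gradKernel.const_smul (sphereArea n)⁻¹

theorem opD_eq (f : Space n → ℝ) :
    opD f = fun x => ∫ y, f y • scaledKernel x y ∂ballMeasure n :=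
  funext fun x => integralOp_eq_integral _ f x

theorem ae_lintegral_scaledKernel_mul_eq (hn : 1 < n) {p : ℝ≥0∞} (hp : 1 ≤ p) {f : Space n → ℝ}
    (hf : MemLp f p (ballMeasure n)) (hf0 : 0 ≤ f) :
    ∀ᵐ x ∂ballMeasure n, ∫⁻ y, ‖scaledKernel x y‖ₑ * ‖f y‖ₑ ∂ballMeasure n = ‖opN f x‖ₑ := by
  filter_upwards [((boundedOnLp_norm_gradKernel hn hp).1 f hf).1] with x hx
  exact lintegral_enorm_smul_mul_eq x hf0 hx

theorem eLpNorm_opN_le_lpOpNorm {p : ℝ≥0∞} (hp : p ≠ 0) {f : Space n → ℝ}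
    (hf : MemLp f p (ballMeasure n)) :
    eLpNorm (opN f) p (ballMeasure n)
      ≤ lpOpNorm (opN (n := n)) p * eLpNorm f p (ballMeasure n) :=
  eLpNorm_le_lpOpNorm hp hf

/-- The marginal is `𝒩[1]`, and the constant `1` has norm one in `L^∞`. -/
theorem ae_lintegral_scaledKernel_le_lpOpNorm_top (hn : 1 < n) :
    ∀ᵐ x ∂ballMeasure n, ∫⁻ y, ‖scaledKernel x y‖ₑ ∂ballMeasure n ≤ lpOpNorm (opN (n := n)) ∞ := by
  have hf : MemLp (fun _ : Space n => (1 : ℝ)) ∞ (ballMeasure n) := memLp_const 1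
  have h1 := eLpNorm_opN_le_lpOpNorm ENNReal.top_ne_zero hf
  rw [eLpNorm_const _ ENNReal.top_ne_zero (ballMeasure_ne_zero n), eLpNorm_exponent_top] at h1
  filter_upwards [ae_lintegral_scaledKernel_mul_eq hn le_top hf fun _ => zero_le_one,
    enorm_ae_le_eLpNormEssSup (opN fun _ : Space n => (1 : ℝ)) (ballMeasure n)] with x hx hx2
  simp only [enorm_one, mul_one] at hx
  rw [hx]
  simpa using hx2.trans h1

/-- For the indicator of `s`, Tonelli's theorem turns the bound on `‖𝒩[1_s]‖_1` into one on the
integral of the marginal over `s`; as `s` is arbitrary, the bound holds almost everywhere. -/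
theorem ae_lintegral_scaledKernel_le_lpOpNorm_one (hn : 1 < n) :
    ∀ᵐ y ∂ballMeasure n, ∫⁻ x, ‖scaledKernel x y‖ₑ ∂ballMeasure n ≤ lpOpNorm (opN (n := n)) 1 := by
  have hKm : Measurable (Function.uncurry fun x y : Space n => ‖scaledKernel x y‖ₑ) :=
    stronglyMeasurable_scaledKernel.enorm
  refine ae_le_of_forall_setLIntegral_le_of_sigmaFinite hKm.lintegral_prod_left' fun s hs hsμ => ?_
  rw [setLIntegral_const]
  set f : Space n → ℝ := s.indicator fun _ => 1 with hf
  have hfe : ∀ y, ‖f y‖ₑ = s.indicator (fun _ => 1) y := fun y => by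
    by_cases hy : y ∈ s <;> simp [hf, hy]
  have hfL : MemLp f 1 (ballMeasure n) := memLp_indicator_const 1 hs 1 (.inr hsμ.ne)
  have hf0 : 0 ≤ f := fun y => Set.indicator_nonneg (fun _ _ => zero_le_one) y
  have h1 := eLpNorm_opN_le_lpOpNorm one_ne_zero hfL
  rw [eLpNorm_one_eq_lintegral_enorm, eLpNorm_one_eq_lintegral_enorm,
    ← lintegral_congr_ae (ae_lintegral_scaledKernel_mul_eq hn le_rfl hfL hf0),
    lintegral_lintegral_swap (aemeasurable_kernel_mul hKm hfL.1.enorm)] at h1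
  simp only [hfe, lintegral_indicator_const hs, one_mul] at h1
  refine le_trans (le_of_eq ?_) h1
  rw [← lintegral_indicator hs]
  refine lintegral_congr fun y => ?_
  by_cases hy : y ∈ s <;> simp [hy]

theorem lpOpNorm_opN_le (hn : 1 < n) {p : ℝ} (hp : 1 < p) :
    lpOpNorm (opN (n := n)) (ENNReal.ofReal p)
      ≤ lpOpNorm (opN (n := n)) 1 ^ (1 / p) * lpOpNorm (opN (n := n)) ∞ ^ ((p - 1) / p) := by
  have hp0 : 0 < p := by linarith
  refine iSup_le fun f => iSup_le fun hf => iSup_le fun hf1 => ?_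
  have h := eLpNorm_kernel_mul_le (K := fun x y : Space n => ‖scaledKernel x y‖ₑ)
    (p := ENNReal.ofReal p) (by simpa using hp.le) stronglyMeasurable_scaledKernel.enorm
    hf.1.enorm (ae_lintegral_scaledKernel_le_lpOpNorm_top hn)
    (ae_lintegral_scaledKernel_le_lpOpNorm_one hn)
  have e : 1 - 1 / p = (p - 1) / p := by field_simp
  rw [eLpNorm_enorm, hf1, mul_one, ENNReal.toReal_ofReal hp0.le, e] at h
  refine le_trans (eLpNorm_mono_enorm fun x => ?_) h
  rw [opN, integralOp_eq_integral, enorm_eq_self]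
  refine (enorm_integral_le_lintegral_enorm _).trans (le_of_eq ?_)
  simp only [scaledKernel, enorm_smul, enorm_norm, mul_comm]

theorem ae_ae_ae_cauchySchwarzDefect_pos (hn : 2 < n) :
    ∀ᵐ x ∂ballMeasure n, ∀ᵐ y ∂ballMeasure n, ∀ᵐ z ∂ballMeasure n,
      0 < cauchySchwarzDefect (scaledKernel x y) (scaledKernel x z) := by
  filter_upwards [ae_ae_ae_linearIndependent hn, ae_ballMeasure_norm_lt n] with x hx hx1
  filter_upwards [hx, ae_ballMeasure_norm_lt n] with y hy hy1
  filter_upwards [hy, ae_ballMeasure_norm_lt n] with z hz hz1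
  have h := sphereArea_pos (n := n) (by omega)
  rw [scaledKernel, scaledKernel, cauchySchwarzDefect_smul]
  have := cauchySchwarzDefect_gradKernel_pos hx1 hy1 hz1 hz
  positivity

theorem ae_prod_cauchySchwarzDefect_pos (hn : 2 < n) :
    ∀ᵐ z ∂(ballMeasure n).prod ((ballMeasure n).prod (ballMeasure n)),
      0 < cauchySchwarzDefect (scaledKernel z.1 z.2.1) (scaledKernel z.1 z.2.2) := by
  have hS : MeasurableSet {z : Space n × (Space n × Space n) |
      0 < cauchySchwarzDefect (scaledKernel z.1 z.2.1) (scaledKernel z.1 z.2.2)} :=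
    measurableSet_lt measurable_const
      (measurable_cauchySchwarzDefect_kernel stronglyMeasurable_scaledKernel)
  rw [Measure.ae_prod_iff_ae_ae hS]
  filter_upwards [ae_ae_ae_cauchySchwarzDefect_pos hn] with x hx
  exact (Measure.ae_prod_iff_ae_ae
    (p := fun w => 0 < cauchySchwarzDefect (scaledKernel x w.1) (scaledKernel x w.2))
    (measurable_prodMk_left hS)).2 hx

/-- If the norm were `0`, then `𝒩[1] = 0` and the kernel would vanish almost everywhere, against the
positive defect. -/
theorem lpOpNorm_opN_ne_zero (hn : 2 < n) {p : ℝ≥0∞} (hp : 1 ≤ p) :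
    lpOpNorm (opN (n := n)) p ≠ 0 := by
  intro h0
  have hp0 : p ≠ 0 := (zero_lt_one.trans_le hp).ne'
  have hf : MemLp (fun _ : Space n => (1 : ℝ)) p (ballMeasure n) := memLp_const 1
  have hb : AEStronglyMeasurable (opN fun _ : Space n => (1 : ℝ)) (ballMeasure n) :=
    ((boundedOnLp_norm_gradKernel (n := n) (by omega) hp).1 _ hf).2.1
  have h1 := eLpNorm_opN_le_lpOpNorm hp0 hf
  rw [h0, zero_mul, nonpos_iff_eq_zero, eLpNorm_eq_zero_iff hb hp0] at h1
  have : (ae (ballMeasure n)).NeBot := ae_neBot.2 (ballMeasure_ne_zero n)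
  obtain ⟨x, hx1, hx2, hx3⟩ := (h1.and ((ae_lintegral_scaledKernel_mul_eq (by omega) hp hf
    fun _ => zero_le_one).and (ae_ae_ae_cauchySchwarzDefect_pos hn))).exists
  simp only [enorm_one, mul_one, hx1, Pi.zero_apply, enorm_zero] at hx2
  have hm : Measurable fun y => ‖scaledKernel x y‖ₑ :=
    (stronglyMeasurable_scaledKernel.comp_measurable measurable_prodMk_left).enorm
  rw [lintegral_eq_zero_iff hm] at hx2
  obtain ⟨y, hy1, hy2⟩ := (hx2.and hx3).exists
  obtain ⟨z, hz⟩ := hy2.exists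
  have : scaledKernel x y = 0 := by simpa using hy1
  simp [this, cauchySchwarzDefect] at hz

theorem lpOpNorm_opD_lt_lpOpNorm_opN (hn : 2 < n) {p : ℝ} (hp : 1 < p) :
    lpOpNorm (opD (n := n)) (ENNReal.ofReal p) < lpOpNorm (opN (n := n)) (ENNReal.ofReal p) := by
  have hn1 : 1 < n := by omega
  have hP : 1 ≤ ENNReal.ofReal p := by simpa using hp.le
  have hbd : ∀ x y : Space n, ‖x‖ < 1 → ‖y‖ < 1 → ‖scaledKernel x y‖ₑ
      ≤ ‖(sphereArea n)⁻¹‖ₑ * (2 * (‖x - y‖ₑ ^ (n - 1))⁻¹) := by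
    intro x y hx hy
    rw [scaledKernel, enorm_smul]
    gcongr
    exact enorm_gradKernel_le hn1 hx hy
  have hWm : Measurable fun z : Space n =>
      ‖(sphereArea n)⁻¹‖ₑ * (2 * (‖z‖ₑ ^ (n - 1))⁻¹) := by fun_prop
  have hW : ∫⁻ z in ball (0 : Space n) 2, ‖(sphereArea n)⁻¹‖ₑ * (2 * (‖z‖ₑ ^ (n - 1))⁻¹) ≠ ∞ := by
    rw [lintegral_const_mul' _ _ (by simp)]
    exact ENNReal.mul_ne_top (by simp) (lintegral_inv_enorm_pow_ne_top hn1 2)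
  obtain ⟨L', hL', hle⟩ := exists_lt_eLpNorm_integral_smul_le (ballMeasure_ne_zero n)
    (stronglyMeasurable_scaledKernel (n := n)) hp
    (boundedOnLp_norm_gradKernel hn1 le_top).2.ne
    (ae_lintegral_scaledKernel_le_lpOpNorm_top hn1) (ae_prod_cauchySchwarzDefect_pos hn)
    (fun ε hε => exists_kernel_split stronglyMeasurable_scaledKernel.enorm hWm hW hbd hε)
    (lpOpNorm_opN_ne_zero hn hP) (boundedOnLp_norm_gradKernel hn1 hP).2.ne
    -- The kernel `|H|` meets `|f|` here, so the bound for `𝒩` is applied to `|f|`, which has the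
    -- same norm as `f`.
    (fun f hf hf1 => by
      have h := eLpNorm_opN_le_lpOpNorm (n := n) (zero_lt_one.trans_le hP).ne' hf.norm
      rw [eLpNorm_norm, hf1, mul_one] at h
      refine le_trans (eLpNorm_mono_enorm_ae ?_) h
      filter_upwards [ae_lintegral_scaledKernel_mul_eq hn1 hP hf.norm fun _ => norm_nonneg _]
        with x hx
      rw [← hx]
      simp)
  refine lt_of_le_of_lt (iSup_le fun f => iSup_le fun hf => iSup_le fun hf1 => ?_) hL'
  rw [opD_eq]
  exact hle f hf hf1

end Main

end PoissonGradient

theorem corollary3 (n : ℕ) (hn : 2 < n) (p : ℝ) (hp : 1 < p) :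
    PoissonGradient.BoundedOnLp
      (fun x y : PoissonGradient.Space n => PoissonGradient.gradKernel x y) (ENNReal.ofReal p) ∧
    PoissonGradient.BoundedOnLp
      (fun x y : PoissonGradient.Space n => ‖PoissonGradient.gradKernel x y‖) (ENNReal.ofReal p) ∧
    PoissonGradient.BoundedOnLp
      (fun x y : PoissonGradient.Space n => ‖PoissonGradient.gradKernel x y‖) 1 ∧
    PoissonGradient.BoundedOnLp
      (fun x y : PoissonGradient.Space n => ‖PoissonGradient.gradKernel x y‖) ⊤ ∧
    PoissonGradient.lpOpNorm (PoissonGradient.opD (n := n)) (ENNReal.ofReal p)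
      < PoissonGradient.lpOpNorm (PoissonGradient.opN (n := n)) (ENNReal.ofReal p) ∧
    PoissonGradient.lpOpNorm (PoissonGradient.opN (n := n)) (ENNReal.ofReal p)
      ≤ PoissonGradient.lpOpNorm (PoissonGradient.opN (n := n)) 1 ^ (1 / p)
        * PoissonGradient.lpOpNorm (PoissonGradient.opN (n := n)) ⊤ ^ ((p - 1) / p) := by
  have hn1 : 1 < n := by omega
  have hP : 1 ≤ ENNReal.ofReal p := by simpa using hp.le
  exact ⟨PoissonGradient.boundedOnLp_gradKernel hn1 hP,
    PoissonGradient.boundedOnLp_norm_gradKernel hn1 hP,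
    PoissonGradient.boundedOnLp_norm_gradKernel hn1 le_rfl,
    PoissonGradient.boundedOnLp_norm_gradKernel hn1 le_top,
    PoissonGradient.lpOpNorm_opD_lt_lpOpNorm_opN hn hp,
    PoissonGradient.lpOpNorm_opN_le hn1 hp⟩
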